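/- **Setting.** Let $\kappa_{abc}\in\mathbb Z$ ($a,b,c=1,\dots,b_2$) be the symmetric triple intersection numbers of a Calabi–Yau threefold, $(xyz)=\kappa_{abc}x^ay^bz^c$. A charge $\check\gamma=(p^a,q_a)$ consists of $p\in\mathbb Z^{b_2}$ with $p^3>0$, $(rp^2)>0$, $k_ap^a>0$ for all effective divisor classes $r$ and effective curve classes $k$, and of $q$ with $q_a-\frac12\kappa_{abc}p^bp^c\in\mathbb Z$. As usual, the cone of such $p$ is closed under addition and consists of effective classes, and for every $p$ in it the matrix $\kappa_{abc}p^c$ has signature $(1,b_2-1)$. Given $n\ge1$ charges $\check\gamma_i$, put $\kappa_{i,ab}=\kappa_{abc}p_i^c$ with inverse $\kappa_i^{ab}$, $\gamma_{ij}=p_j^aq_{i,a}-p_i^aq_{j,a}$, and on $\mathbb R^{nb_2}$ put $\boldsymbol x\cdot\boldsymbol y=\sum_i\kappa_{i,ab}x_i^ay_i^b$, $v_{ij,k}^a=\delta_{ki}p_j^a-\delta_{kj}p_i^a$, $\mathcal D(\boldsymbol v)=\boldsymbol v\cdot(\boldsymbol x+\frac1{2\pi}\partial_{\boldsymbol x})$.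 *Generalized error functions.* For $k$ independent vectors $\mathcal V=(\boldsymbol v_1,\dots,\boldsymbol v_k)$ spanning a positive definite subspace with orthonormal basis $\mathcal B$, let $\Phi^E_k(\mathcal V;\boldsymbol x)=E_k(\mathcal B\cdot\mathcal V;\mathcal B\cdot\boldsymbol x)$, where $E_k(M;u)=\int_{\mathbb R^k}du'\,e^{-\pi\sum_i(u_i-u'_i)^2}\prod_i\operatorname{sgn}((M^{\rm tr}u')_i)$, $\operatorname{sgn}(0)=0$, $\Phi^E_0=1$. *Trees.* All trees are unrooted, with edges oriented arbitrarily, an edge $e$ going from $s(e)$ to $t(e)$. $\mathbb T^\ell_{n-2m,m}$ is the set of trees with $n-2m$ vertices and $m$ marks distributed over the vertices, where a vertex $v$ with $m_v$ marks carries $1+2m_v$ of the charges $\check\gamma_1,\dots,\check\gamma_n$, each charge being carried by exactly one vertex; $\mathbb T^\ell_k$ is the set of labelled trees with $k$ vertices and no marks. The charge of a vertex is the sum of the charges it carries, and $\gamma_{vw}$, $\boldsymbol v_{vw}$ for vertices are defined by additivity. Removing an edge $e$ from $\mathcal T$ gives two trees $\mathcal T_e^s\ni s(e)$ and $\mathcal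 T_e^t\ni t(e)$; set $\boldsymbol v_e=\sum_{i\in\mathcal T^s_e,\,j\in\mathcal T^t_e}\boldsymbol v_{ij}$, $\Gamma_e=\sum_{i\in\mathcal T^s_e,\,j\in\mathcal T^t_e}\gamma_{ij}$, $\kappa_{\mathcal T}=\prod_e\gamma_{s(e)t(e)}$ and $\Phi^E_{\mathcal T}(\boldsymbol x)=\Phi^E_{|E_{\mathcal T}|}(\{\boldsymbol v_e\};\boldsymbol x)$. The rational numbers $a_{\mathcal T}$ are defined by $a_\bullet=1$ and $a_{\mathcal T}=\frac1{n_{\mathcal T}}\sum_{v}(-1)^{n_v^+}\prod_sa_{\mathcal T_s(v)}$, where $n_{\mathcal T}$ is the number of vertices, $n_v^+$ is the number of edges incoming at $v$ and $\mathcal T_s(v)$ are the trees left after removing $v$. For a vertex with $m$ marks put $$\mathcal D_m=\sum_{\mathcal T\in\mathbb T^\ell_{2m+1}}a_{\mathcal T}\prod_e\mathcal D(\boldsymbol v_{s(e)t(e)}),\qquad \mathcal V_m=\sum_{\mathcal T\in\mathbb T^\ell_{2m+1}}a_{\mathcal T}\,\kappa_{\mathcal T},$$ the trees being labelled by the charges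 of the vertex. The vertex functions are $$\mathcal E_n(\{\check\gamma_i\};\tau_2)=\frac{1}{(\sqrt{2\tau_2})^{n-1}}\,\frac1{n!}\sum_{m=0}^{\lfloor (n-1)/2\rfloor}\ \sum_{\mathcal T\in\mathbb T^\ell_{n-2m,m}}\Big[\prod_{v}\mathcal D_{m_v}\prod_{e}\mathcal D(\boldsymbol v_{s(e)t(e)})\Big]\Phi^E_{\mathcal T}(\boldsymbol x),\qquad x_i^a=\sqrt{2\tau_2}\,\kappa_i^{ab}q_{i,b}.$$ **Statement.** (1) For all charges $\check\gamma_1,\dots,\check\gamma_n$, the limit $\mathcal E^{(0)}_n=\lim_{\tau_2\to\infty}\mathcal E_n(\{\check\gamma_i\};\tau_2)$ exists and $$\mathcal E^{(0)}_n=\frac1{n!}\sum_{m=0}^{\lfloor (n-1)/2\rfloor}\ \sum_{\mathcal T\in\mathbb T^\ell_{n-2m,m}}\Big[\prod_{v}\mathcal V_{m_v}\Big]\kappa_{\mathcal T}\,\mathsf S_{\mathcal T},\qquad \mathsf S_{\mathcal T}=\sum_{\mathcal J\subseteq E_{\mathcal T}}\Phi^E_{\mathcal T_{\mathcal J}}(0)\prod_{e\in\mathcal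 J}\delta_{\Gamma_e}\prod_{e\in E_{\mathcal T}\setminus\mathcal J}\operatorname{sgn}(\Gamma_e),$$ where $\delta_x=1$ if $x=0$ and $\delta_x=0$ otherwise, and $\mathcal T_{\mathcal J}$ is obtained from $\mathcal T$ by contracting the edges not in $\mathcal J$. (2) Let $\mathcal T_1,\mathcal T_2,\mathcal T_3$ be trees with chosen vertices $v_1,v_2,v_3$, and consider the edges $e_1:v_1\to v_2$, $e_2:v_1\to v_3$, $e_3:v_2\to v_3$. Let $\hat{\mathcal T}_1,\hat{\mathcal T}_2,\hat{\mathcal T}_3$ be the trees obtained from $\mathcal T_1\sqcup\mathcal T_2\sqcup\mathcal T_3$ by adding $\{e_1,e_2\}$, $\{e_2,e_3\}$, $\{e_1,e_3\}$ respectively, with charges distributed over the vertices so that each vertex carries at least one, and let $\mathcal T$ be the tree obtained from any of them by contracting the two added edges. Then $\mathsf e_{\mathcal T}=\Phi^E_{\mathcal T}(0)$ satisfies $$\mathsf e_{\hat{\mathcal T}_1}+\mathsf e_{\hat{\mathcal T}_2}-\mathsf e_{\hat{\mathcal T}_3}=-\mathsf e_{\mathcal T}.$$ (3) The formula in (1)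 with $\mathsf S_{\mathcal T}$ replaced by $\prod_{e\in E_{\mathcal T}}\operatorname{sgn}(\Gamma_e)$ is not correct in general: there are an $n\ge 1$, data $\kappa_{abc}$, effective classes as above and charges $\check\gamma_1,\dots,\check\gamma_n$ for which it does not give the limit of $\mathcal E_n$. -/

import Mathlib

namespace D4Completion

noncomputable section

open scoped Classical
open Matrix

/-! ### Intersection data and charges -/

/-- The cubic form `(pqr) = κ_{abc} p^a q^b r^c` of integer classes. -/
def cubic {b : ℕ} (κ : Fin b → Fin b → Fin b → ℤ) (p q r : Fin b → ℤ) : ℤ :=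
  ∑ i, ∑ j, ∑ k, κ i j k * p i * q j * r k

/-- The matrix `κ_{ab} = κ_{abc} p^c`. -/
def kappaMat {b : ℕ} (κ : Fin b → Fin b → Fin b → ℤ) (p : Fin b → ℤ) :
    Matrix (Fin b) (Fin b) ℝ :=
  Matrix.of fun i j => ∑ k, (κ i j k : ℝ) * (p k : ℝ)

/-- The conditions `p³ > 0`, `(r p²) > 0` and `k · p > 0` for all effective divisor classes `r`
and all effective curve classes `k`. -/
def InChargeCone {b : ℕ} (κ : Fin b → Fin b → Fin b → ℤ)
    (effDiv effCurve : Set (Fin b → ℤ)) (p : Fin b → ℤ) : Prop :=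
  0 < cubic κ p p p ∧ (∀ r ∈ effDiv, 0 < cubic κ r p p) ∧ (∀ k ∈ effCurve, 0 < ∑ a, k a * p a)

/-- The part of the geometry of a Calabi-Yau threefold with `b₂ = b` that is used: the symmetric
triple intersection numbers, the effective divisor and curve classes (in dual bases of `H₄` and
`H₂`), and the standard facts that the cone of D4-brane charges (the ample cone) is closed under
addition and consists of effective classes, and that `κ_{abc} p^c` has signature `(1, b - 1)` for
each `p` in it. -/
structure IntersectionData (b : ℕ) where
  κ : Fin b → Fin b → Fin b → ℤ
  κ_swap_left : ∀ i j k, κ i j k = κ j i k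
  κ_swap_right : ∀ i j k, κ i j k = κ i k j
  effDiv : Set (Fin b → ℤ)
  effCurve : Set (Fin b → ℤ)
  cone_add : ∀ p p', InChargeCone κ effDiv effCurve p → InChargeCone κ effDiv effCurve p' →
    InChargeCone κ effDiv effCurve (p + p')
  cone_effective : ∀ p, InChargeCone κ effDiv effCurve p → p ∈ effDiv
  signature_pos : ∀ p, InChargeCone κ effDiv effCurve p →
    sigPos (kappaMat κ p).toQuadraticForm' = 1
  signature_neg : ∀ p, InChargeCone κ effDiv effCurve p →
    sigNeg (kappaMat κ p).toQuadraticForm' + 1 = b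

/-- A reduced charge vector `(p^a, q_a)`: `p` is a D4-brane charge in the cone and
`q ∈ Λ* + p/2`, i.e. `q_a - κ_{abc} p^b p^c / 2` is an integer. -/
structure Charge {b : ℕ} (X : IntersectionData b) where
  p : Fin b → ℤ
  q : Fin b → ℝ
  p_mem : InChargeCone X.κ X.effDiv X.effCurve p
  q_mem : ∀ i, ∃ z : ℤ, q i = z + (1 / 2) * ∑ j, kappaMat X.κ p i j * (p j : ℝ)

section Vectors

variable {b n : ℕ} {X : IntersectionData b} (γ : Fin n → Charge X)

/-- The Dirac product `γ_{ij} = p_j^a q_{i,a} - p_i^a q_{j,a}`. -/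
def dirac (i j : Fin n) : ℝ :=
  ∑ a, (((γ j).p a : ℝ) * (γ i).q a - ((γ i).p a : ℝ) * (γ j).q a)

/-- The `n b`-dimensional vectors `v_{ij}`, `v_{ij,k}^a = δ_{ki} p_j^a - δ_{kj} p_i^a`. -/
def vec (i j : Fin n) : Fin n → Fin b → ℝ := fun k a =>
  (if k = i then ((γ j).p a : ℝ) else 0) - (if k = j then ((γ i).p a : ℝ) else 0)

/-- The bilinear form `x · y = ∑_i κ_{abc} p_i^a x_i^b y_i^c`. -/
def biform (x y : Fin n → Fin b → ℝ) : ℝ :=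
  ∑ i, ∑ a, ∑ c, kappaMat X.κ (γ i).p a c * x i a * y i c

/-- The point with components `x_i^a = √(2τ₂) κ_i^{ab} q_{i,b}`. -/
def point (τ₂ : ℝ) : Fin n → Fin b → ℝ := fun i a =>
  Real.sqrt (2 * τ₂) * ((kappaMat X.κ (γ i).p)⁻¹ *ᵥ (γ i).q) a

/-- The operator `𝒟(v) = v · (x + (1/2π) ∂_x)`. -/
def diffOp (v : Fin n → Fin b → ℝ) (f : (Fin n → Fin b → ℝ) → ℝ) :
    (Fin n → Fin b → ℝ) → ℝ := fun x =>
  biform γ v x * f x + (1 / (2 * Real.pi)) * fderiv ℝ f x v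

/-- The composition of the operators `op e`, taken in some order. The operators to which this
is applied commute with each other on smooth functions. -/
def opProd {E F : Type} [Fintype E] (op : E → F → F) (f : F) : F :=
  ((Finset.univ : Finset E).toList.map op).foldr (fun D g => D g) f

end Vectors

/-! ### Generalized error functions -/

/-- `E_n(M; u) = ∫ du' exp(-π ∑ (u_i - u'_i)²) ∏ sgn((Mᵗ u')_i)`, with `n = |E|`. -/
def genErr {E : Type} [Fintype E] (M : Matrix E E ℝ) (u : E → ℝ) : ℝ :=
  ∫ u' : E → ℝ, Real.exp (-Real.pi * ∑ i, (u i - u' i) ^ 2) * ∏ i, Real.sign ((Mᵀ *ᵥ u') i)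

/-- `f` is an orthonormal basis, with respect to `B`, of the span of the vectors `v`. -/
def IsOrthonormalFrame {E W : Type} [AddCommGroup W] [Module ℝ W] (B : W → W → ℝ)
    (v f : E → W) : Prop :=
  (∀ i j, B (f i) (f j) = if i = j then 1 else 0) ∧
    Submodule.span ℝ (Set.range f) = Submodule.span ℝ (Set.range v)

/-- The boosted function `Φ^E_n(V; x) = E_n(ℬ·V; ℬ·x)`, where `ℬ` is an orthonormal basis of the
span of the `n = |E|` vectors in `V`. Such a basis exists exactly when the vectors are independent
and span a positive definite subspace; the value does not depend on which one is chosen. -/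
def boostedErr {E W : Type} [Fintype E] [AddCommGroup W] [Module ℝ W] (B : W → W → ℝ)
    (v : E → W) (x : W) : ℝ :=
  if h : ∃ f : E → W, IsOrthonormalFrame B v f then
    genErr (Matrix.of fun k i => B (h.choose k) (v i)) (fun k => B (h.choose k) x)
  else 0

/-! ### Trees -/

/-- An oriented graph with vertices `V` and edges `E`. -/
structure OGraph (V E : Type) where
  src : E → V
  tgt : E → V

namespace OGraph

variable {V E : Type} (T : OGraph V E)

/-- `u` and `v` are joined by an undirected path with edges in `A`. -/
def Linked (A : Set E) : V → V → Prop :=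
  Relation.EqvGen fun u v => ∃ e ∈ A, T.src e = u ∧ T.tgt e = v

/-- `T` is an (unrooted) tree: it is non-empty and connected, and removing any edge
disconnects its ends. -/
def IsTree : Prop :=
  Nonempty V ∧ (∀ u v, T.Linked Set.univ u v) ∧ ∀ e, ¬ T.Linked {e}ᶜ (T.src e) (T.tgt e)

/-- The vertices of the component of the source of `e` after `e` is removed. -/
def srcSide (e : E) : Set V := {v | T.Linked {e}ᶜ (T.src e) v}

/-- The vertices of the component of the target of `e` after `e` is removed. -/
def tgtSide (e : E) : Set V := {v | T.Linked {e}ᶜ (T.tgt e) v}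

/-- The equivalence relation on vertices given by contracting all edges outside `J`. -/
def contractSetoid (J : Finset E) : Setoid V where
  r := T.Linked {e | e ∉ J}
  iseqv := Relation.EqvGen.is_equivalence _

/-- The tree `T_J` obtained by contracting the edges not in `J`. -/
def contract (J : Finset E) : OGraph (Quotient (T.contractSetoid J)) J where
  src e := Quotient.mk _ (T.src e)
  tgt e := Quotient.mk _ (T.tgt e)

/-- The components of the subgraph induced on `S`. -/
def comps (S : Finset V) : Finset (Finset V) :=
  S.image fun u => S.filter fun w => T.Linked {e | T.src e ∈ S ∧ T.tgt e ∈ S} u w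

/-- The number of incoming edges at `v` in the subgraph induced on `S ∋ v`. -/
def inDeg [Fintype E] (S : Finset V) (v : V) : ℕ :=
  (Finset.univ.filter fun e => T.tgt e = v ∧ T.src e ∈ S).card

theorem card_lt_of_mem_comps {S C : Finset V} {v : V} (hv : v ∈ S)
    (hC : C ∈ T.comps (S.erase v)) : C.card < S.card := by
  obtain ⟨u, -, rfl⟩ := Finset.mem_image.1 hC
  exact lt_of_le_of_lt (Finset.card_le_card (Finset.filter_subset _ _))
    (Finset.card_erase_lt_of_mem hv)

/-- The coefficient `a` of the subtree induced on `S`: the average over `v ∈ S` of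
`(-1)^{n_v^+}` times the product of the coefficients of the subtrees left after removing `v`. -/
def aSub [Fintype E] (S : Finset V) : ℚ :=
  (1 / (S.card : ℚ)) * ∑ v : {v // v ∈ S}, (-1 : ℚ) ^ T.inDeg S v.1 *
    ∏ C : {C // C ∈ T.comps (S.erase v.1)}, aSub C.1
termination_by S.card
decreasing_by exact T.card_lt_of_mem_comps v.2 C.2

/-- The coefficient `a_T`. -/
def aCoef [Fintype V] [Fintype E] : ℚ := T.aSub Finset.univ

section Labelled

/-! The vertices of `T` carry the charges `γ_i`; `c i` is the vertex carrying the `i`-th one, and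
the charge of a vertex is the sum of the charges which it carries. -/

variable {b n : ℕ} {X : IntersectionData b} (γ : Fin n → Charge X) (c : Fin n → V)

/-- `v_e = ∑_{i ∈ T_e^s} ∑_{j ∈ T_e^t} v_{ij}`. -/
def edgeVec (e : E) : Fin n → Fin b → ℝ :=
  ∑ i with c i ∈ T.srcSide e, ∑ j with c j ∈ T.tgtSide e, vec γ i j

/-- `Γ_e = ∑_{i ∈ T_e^s} ∑_{j ∈ T_e^t} γ_{ij}`. -/
def edgeDirac (e : E) : ℝ :=
  ∑ i with c i ∈ T.srcSide e, ∑ j with c j ∈ T.tgtSide e, dirac γ i j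

/-- `v_{s(e)t(e)}` for the charges of the two ends of `e`. -/
def endVec (e : E) : Fin n → Fin b → ℝ :=
  ∑ i with c i = T.src e, ∑ j with c j = T.tgt e, vec γ i j

/-- `γ_{s(e)t(e)}`, the Dirac product of the charges of the two ends of `e`. -/
def endDirac (e : E) : ℝ :=
  ∑ i with c i = T.src e, ∑ j with c j = T.tgt e, dirac γ i j

/-- `Φ^E_T(x) = Φ^E_{|E_T|}({v_e}; x)`. -/
def treeErr [Fintype E] (x : Fin n → Fin b → ℝ) : ℝ :=
  boostedErr (biform γ) (T.edgeVec γ c) x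

/-- `κ_T = ∏_e γ_{s(e)t(e)}`. -/
def kappa [Fintype E] : ℝ := ∏ e, T.endDirac γ c e

/-- `𝖾_{T_J} = Φ^E_{T_J}(0)`, for the tree `T_J` obtained by contracting the edges not in `J`;
its vertices carry the charges of all the vertices of `T` which are identified. -/
def eContract (J : Finset E) : ℝ :=
  (T.contract J).treeErr γ (fun i => Quotient.mk (T.contractSetoid J) (c i)) 0

/-- `𝖲_T = ∑_{J ⊆ E_T} 𝖾_{T_J} ∏_{e ∈ J} δ_{Γ_e} ∏_{e ∉ J} sgn(Γ_e)`. -/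
def signSum [Fintype E] : ℝ :=
  ∑ J : Finset E, T.eContract γ c J * (∏ e ∈ J, if T.edgeDirac γ c e = 0 then (1 : ℝ) else 0) *
    ∏ e ∈ Jᶜ, Real.sign (T.edgeDirac γ c e)

/-- `∏_e sgn(Γ_e)`. -/
def signProd [Fintype E] : ℝ := ∏ e, Real.sign (T.edgeDirac γ c e)

end Labelled

end OGraph

/-- Three trees with chosen vertices `u r` are joined by two additional edges, from `u i` to `u j`
and from `u k` to `u l`. -/
def glue {V E : Fin 3 → Type} (T : ∀ r, OGraph (V r) (E r)) (u : ∀ r, V r) (i j k l : Fin 3) :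
    OGraph (Σ r, V r) ((Σ r, E r) ⊕ Bool) where
  src := Sum.elim (fun e => ⟨e.1, (T e.1).src e.2⟩) fun s => if s then ⟨k, u k⟩ else ⟨i, u i⟩
  tgt := Sum.elim (fun e => ⟨e.1, (T e.1).tgt e.2⟩) fun s => if s then ⟨l, u l⟩ else ⟨j, u j⟩

/-- The trees `T̂₁`, `T̂₂`, `T̂₃` (numbered from `0`) built from three trees with chosen vertices
`u₁`, `u₂`, `u₃` and the oriented edges `e₁ : u₁ → u₂`, `e₂ : u₁ → u₃`, `e₃ : u₂ → u₃`: the tree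
`T̂₁` uses `e₁, e₂`, the tree `T̂₂` uses `e₂, e₃` and the tree `T̂₃` uses `e₁, e₃`. -/
def hatTree {V E : Fin 3 → Type} (T : ∀ r, OGraph (V r) (E r)) (u : ∀ r, V r) :
    Fin 3 → OGraph (Σ r, V r) ((Σ r, E r) ⊕ Bool) :=
  ![glue T u 0 1 0 2, glue T u 0 2 1 2, glue T u 0 1 1 2]

/-- The edges of a glued tree other than the two additional ones. -/
def oldEdges {E : Fin 3 → Type} [∀ r, Fintype (E r)] : Finset ((Σ r, E r) ⊕ Bool) :=
  Finset.univ.filter fun e => e.isLeft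

/-! ### Labelled trees and marked trees -/

/-- A choice of orientation of every edge that a graph on `V` can have. -/
structure EdgeOrientation (V : Type) where
  src : Sym2 V → V
  tgt : Sym2 V → V
  spec : ∀ e, s(src e, tgt e) = e

/-- Trees with vertex set `V`. -/
abbrev TreeOn (V : Type) : Type := {G : SimpleGraph V // G.IsTree}

/-- The oriented tree given by a tree on `V` and a choice of orientations. -/
def TreeOn.toOGraph {V : Type} (o : EdgeOrientation V) (G : TreeOn V) : OGraph V G.1.edgeSet where
  src e := o.src e.1
  tgt e := o.tgt e.1

/-- The ways of distributing `n` labels over the vertices of a marked tree with `n - 2m` vertices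
and `m` marks: partitions of the labels into `n - 2m` blocks of odd size, where the block of size
`1 + 2 m_v` belongs to a vertex `v` with `m_v` marks (so that `∑ m_v = m`). -/
def markedPartitions (n m : ℕ) : Finset (Finpartition (Finset.univ : Finset (Fin n))) :=
  Finset.univ.filter fun P => P.parts.card + 2 * m = n ∧ ∀ B ∈ P.parts, Odd B.card

/-- The vertices of the marked trees with label distribution `P` are the blocks of `P`. -/
abbrev Blocks {n : ℕ} (P : Finpartition (Finset.univ : Finset (Fin n))) : Type :=
  {B // B ∈ P.parts}

/-- The block containing a label. -/
def blockOf {n : ℕ} (P : Finpartition (Finset.univ : Finset (Fin n))) (i : Fin n) : Blocks P :=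
  ⟨P.part i, P.part_mem.2 (Finset.mem_univ i)⟩

/-! ### The functions `ℰ_n` and their limits -/

section Main

variable {b n : ℕ} {X : IntersectionData b} (o : ∀ V : Type, EdgeOrientation V)
  (γ : Fin n → Charge X)

/-- The operator `𝒟_m({p_s})` of a vertex carrying the `2m + 1` charges in `B`: the sum over trees
with these labels of `a_T ∏_e 𝒟(v_{s(e)t(e)})`. -/
def markOp (B : Finset (Fin n)) (f : (Fin n → Fin b → ℝ) → ℝ) : (Fin n → Fin b → ℝ) → ℝ :=
  fun x => ∑ G : TreeOn {i // i ∈ B}, ((G.toOGraph (o _)).aCoef : ℝ) *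
    opProd (fun e => diffOp γ (vec γ ((G.toOGraph (o _)).src e).1 ((G.toOGraph (o _)).tgt e).1)) f x

/-- `𝒱_m({γ_s}) = ∑_T a_T κ_T({γ_s})` for the `2m + 1` charges in `B`. -/
def markFactor (B : Finset (Fin n)) : ℝ :=
  ∑ G : TreeOn {i // i ∈ B}, ((G.toOGraph (o _)).aCoef : ℝ) *
    ∏ e, dirac γ ((G.toOGraph (o _)).src e).1 ((G.toOGraph (o _)).tgt e).1

/-- `Φ^ℰ_n(x)`, the sum over marked trees of
`[∏_v 𝒟_{m_v} ∏_e 𝒟(v_{s(e)t(e)})] Φ^E_T(x)`, divided by `n!`. -/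
def vertexKernel (x : Fin n → Fin b → ℝ) : ℝ :=
  (1 / (n.factorial : ℝ)) * ∑ m ∈ Finset.range ((n - 1) / 2 + 1),
    ∑ P ∈ markedPartitions n m, ∑ G : TreeOn (Blocks P),
      opProd (fun B : Blocks P => markOp o γ B.1)
        (opProd (fun e => diffOp γ ((G.toOGraph (o _)).endVec γ (blockOf P) e))
          ((G.toOGraph (o _)).treeErr γ (blockOf P))) x

/-- `ℰ_n({γ_i}; τ₂) = Φ^ℰ_n(x) / (√(2τ₂))^{n-1}`. -/
def vertexFn (τ₂ : ℝ) : ℝ :=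
  vertexKernel o γ (point γ τ₂) / Real.sqrt (2 * τ₂) ^ (n - 1)

/-- The sum over marked trees of `[∏_v 𝒱_{m_v}] κ_T 𝖲_T`, divided by `n!`. -/
def vertexLimit : ℝ :=
  (1 / (n.factorial : ℝ)) * ∑ m ∈ Finset.range ((n - 1) / 2 + 1),
    ∑ P ∈ markedPartitions n m, ∑ G : TreeOn (Blocks P),
      (∏ B : Blocks P, markFactor o γ B.1) * (G.toOGraph (o _)).kappa γ (blockOf P) *
        (G.toOGraph (o _)).signSum γ (blockOf P)

/-- The same expression with the product of signs `∏_e sgn(Γ_e)` in place of `𝖲_T`. -/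
def naiveVertexLimit : ℝ :=
  (1 / (n.factorial : ℝ)) * ∑ m ∈ Finset.range ((n - 1) / 2 + 1),
    ∑ P ∈ markedPartitions n m, ∑ G : TreeOn (Blocks P),
      (∏ B : Blocks P, markFactor o γ B.1) * (G.toOGraph (o _)).kappa γ (blockOf P) *
        (G.toOGraph (o _)).signProd γ (blockOf P)

end Main

end

end D4Completion

/-!
`Φ^E_T` is the Gaussian average of the product of signs of the linear forms `v_e · u`. Along the
ray `x = √(2τ₂) κ⁻¹ q` each `D(v)` acts to leading order as multiplication by
`v · x = √(2τ₂) γ`, its derivative part being of lower order. The forms with `Γ_e ≠ 0` have large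
arguments and become constant signs, while those with `Γ_e = 0` are averaged at the origin: an
expansion over the set of vanishing `Γ_e` gives `𝖲_T`. That the vectors `v_e` of a tree are
independent and span a positive definite subspace comes from the Hodge index theorem for `κ_i`.

For the second part, the vectors attached to the three pairs of branches satisfy `v₃ = v₁ + v₂` up
to orientation, and `sgn a sgn b - sgn (a + b) (sgn a + sgn b) = -1` away from the hyperplanes
`a = 0`, `b = 0`, `a + b = 0`, so the identity holds under the Gaussian average.

For the third part, take three charges with `γ₁₂ = γ₂₃ = γ₃₁ ≠ 0`. Every `Γ_e` then vanishes, so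
all products of signs do, while `Φ^E(0)` survives and, by the second part, contributes a nonzero
multiple of `γ₁₂²` to the limit.
-/

open MeasureTheory Filter Topology
open scoped Matrix ContDiff SchwartzMap

namespace D4Completion

noncomputable section

open scoped Classical

/-! ### Gaussians as Schwartz functions -/

section SchwartzGaussian

variable {E : Type*} [NormedAddCommGroup E] [NormedSpace ℝ E]

lemma exists_pow_mul_exp_neg_mul_sq_le {c : ℝ} (hc : 0 < c) (N : ℕ) :
    ∃ A, ∀ r : ℝ, 0 ≤ r → (1 + r) ^ N * Real.exp (-(c * r ^ 2)) ≤ A := by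
  refine ⟨Real.exp ((N : ℝ) ^ 2 / (4 * c)), fun r hr => ?_⟩
  have complete_square : N * r - c * r ^ 2 ≤ (N : ℝ) ^ 2 / (4 * c) := by
    rw [le_div_iff₀ (by positivity)]
    nlinarith [sq_nonneg (N - 2 * c * r)]
  calc (1 + r) ^ N * Real.exp (-(c * r ^ 2))
      ≤ Real.exp r ^ N * Real.exp (-(c * r ^ 2)) := by
        gcongr
        linarith [Real.add_one_le_exp r]
    _ = Real.exp (N * r - c * r ^ 2) := by
        rw [← Real.exp_nat_mul, ← Real.exp_add, sub_eq_add_neg]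
    _ ≤ Real.exp ((N : ℝ) ^ 2 / (4 * c)) := Real.exp_le_exp.2 complete_square

lemma exists_norm_iteratedFDeriv_exp_comp_le {q : E → ℝ} (hq : q.HasTemperateGrowth) (n : ℕ) :
    ∃ (m : ℕ) (C : ℝ), 0 ≤ C ∧ ∀ u,
      ‖iteratedFDeriv ℝ n (fun v => Real.exp (q v)) u‖ ≤ C * (1 + ‖u‖) ^ m * Real.exp (q u) := by
  obtain ⟨m, C, hC, hle⟩ := hq.norm_iteratedFDeriv_le_uniform n
  refine ⟨m * n, n.factorial * (C + 1) ^ n, by positivity, fun u => ?_⟩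
  have outer : ∀ i ≤ n, ‖iteratedFDeriv ℝ i Real.exp (q u)‖ ≤ Real.exp (q u) := fun i _ => by
    rw [norm_iteratedFDeriv_eq_norm_iteratedDeriv, iteratedDeriv_eq_iterate, Real.iter_deriv_exp,
      Real.norm_of_nonneg (Real.exp_nonneg _)]
  have inner_le : ∀ i, 1 ≤ i → i ≤ n →
      ‖iteratedFDeriv ℝ i q u‖ ≤ ((C + 1) * (1 + ‖u‖) ^ m) ^ i := fun i hi hin => by
    have hu : 1 ≤ (1 + ‖u‖) ^ m := one_le_pow₀ (by simp)
    calc ‖iteratedFDeriv ℝ i q u‖ ≤ C * (1 + ‖u‖) ^ m := hle i hin u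
      _ ≤ (C + 1) * (1 + ‖u‖) ^ m := by gcongr; linarith
      _ ≤ ((C + 1) * (1 + ‖u‖) ^ m) ^ i := le_self_pow₀ (by nlinarith) (by omega)
  refine (norm_iteratedFDeriv_comp_le Real.contDiff_exp (hq.1.of_le (by exact_mod_cast le_top))
    le_rfl u outer inner_le).trans_eq ?_
  rw [mul_pow, ← pow_mul]
  ring

/-- The Schwartz function `exp (-q)`, for a function `q` of temperate growth which dominates a
multiple of `‖u‖²`. -/
def schwartzExpNeg (q : E → ℝ) (hq : q.HasTemperateGrowth)
    (hcoer : ∃ c, 0 < c ∧ ∀ u, c * ‖u‖ ^ 2 ≤ q u) : 𝓢(E, ℝ) where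
  toFun u := Real.exp (-q u)
  smooth' := Real.contDiff_exp.comp hq.1.neg
  decay' k n := by
    obtain ⟨c, hc, hcq⟩ := hcoer
    obtain ⟨m, C, hC, hle⟩ := exists_norm_iteratedFDeriv_exp_comp_le hq.neg n
    obtain ⟨A, hA⟩ := exists_pow_mul_exp_neg_mul_sq_le hc (k + m)
    refine ⟨C * A, fun u => ?_⟩
    calc ‖u‖ ^ k * ‖iteratedFDeriv ℝ n (fun v => Real.exp (-q v)) u‖
        ≤ (1 + ‖u‖) ^ k * (C * (1 + ‖u‖) ^ m * Real.exp (-(c * ‖u‖ ^ 2))) := by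
          gcongr
          · linarith
          · refine (hle u).trans ?_
            gcongr
            exact neg_le_neg (hcq u)
      _ = C * ((1 + ‖u‖) ^ (k + m) * Real.exp (-(c * ‖u‖ ^ 2))) := by
          rw [pow_add]
          ring
      _ ≤ C * A := by
          gcongr
          exact hA _ (norm_nonneg u)

variable {K : Type*} [Fintype K]

lemma norm_sq_le_sum_sq (u : K → ℝ) : ‖u‖ ^ 2 ≤ ∑ i, u i ^ 2 := by
  have hle : ‖u‖ ≤ √(∑ i, u i ^ 2) :=
    (pi_norm_le_iff_of_nonneg (Real.sqrt_nonneg _)).2 fun i => Real.abs_le_sqrt <|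
      Finset.single_le_sum (f := fun i => u i ^ 2) (fun _ _ => sq_nonneg _) (Finset.mem_univ i)
  rwa [Real.le_sqrt (norm_nonneg _) (Finset.sum_nonneg fun i _ => sq_nonneg _)] at hle

lemma hasTemperateGrowth_sum_sq : (fun u : K → ℝ => ∑ i, u i ^ 2).HasTemperateGrowth :=
  .sum fun i _ =>
    (ContinuousLinearMap.proj (R := ℝ) (φ := fun _ : K => ℝ) i).hasTemperateGrowth.pow 2

variable (K) in
/-- The Gaussian `exp (-π ∑ u_i²)`, the kernel of the generalized error functions. -/
def gaussSchwartz : 𝓢(K → ℝ, ℝ) :=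
  schwartzExpNeg (fun u => Real.pi * ∑ i, u i ^ 2)
    ((Function.HasTemperateGrowth.const _).mul hasTemperateGrowth_sum_sq)
    ⟨Real.pi, Real.pi_pos, fun u => mul_le_mul_of_nonneg_left (norm_sq_le_sum_sq u)
      Real.pi_pos.le⟩

lemma gaussSchwartz_apply (u : K → ℝ) :
    gaussSchwartz K u = Real.exp (-Real.pi * ∑ i, u i ^ 2) := by
  rw [neg_mul]
  rfl

end SchwartzGaussian

/-! ### The Gaussian measure -/

section Gauss

variable {K J : Type*} [Fintype K] [Fintype J]

variable (K) in
/-- The probability measure on `ℝ^K` with density `exp (-π ∑ u_i²)`, which turns generalized error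
functions into averages of products of signs. -/
def gaussMeasure : Measure (K → ℝ) :=
  volume.withDensity fun u => ENNReal.ofReal (gaussSchwartz K u)

lemma integral_gaussMeasure {G : Type*} [NormedAddCommGroup G] [NormedSpace ℝ G]
    (F : (K → ℝ) → G) :
    ∫ u, F u ∂gaussMeasure K = ∫ u, Real.exp (-Real.pi * ∑ i, u i ^ 2) • F u := by
  rw [gaussMeasure, integral_withDensity_eq_integral_toReal_smul
    (gaussSchwartz K).continuous.measurable.ennreal_ofReal (by simp)]
  simp only [gaussSchwartz_apply, ENNReal.toReal_ofReal (Real.exp_nonneg _)]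

lemma dual_apply_eq_sum (L : StrongDual ℝ (K → ℝ)) (u : K → ℝ) :
    L u = ∑ i, u i * L (Pi.single i 1) := by
  conv_lhs => rw [pi_eq_sum_univ' u, map_sum]
  simp only [map_smul, smul_eq_mul]

lemma charFunDual_gaussMeasure (L : StrongDual ℝ (K → ℝ)) :
    charFunDual (gaussMeasure K) L =
      Complex.exp ((-(∑ i, L (Pi.single i 1) ^ 2) / (4 * Real.pi) : ℝ)) := by
  have fourier := GaussianFourier.integral_cexp_neg_mul_sum_add (b := (Real.pi : ℂ)) (ι := K)
    (by simpa using Real.pi_pos) (fun i => (L (Pi.single i 1) : ℂ) * Complex.I)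
  rw [div_self (by exact_mod_cast Real.pi_ne_zero), Complex.one_cpow, one_mul] at fourier
  rw [charFunDual_apply, integral_gaussMeasure]
  convert fourier using 1
  · refine integral_congr_ae (Eventually.of_forall fun u => ?_)
    simp only [Complex.exp_add, Complex.real_smul, dual_apply_eq_sum L u]
    push_cast
    rw [Finset.sum_mul]
    congr 2
    exact Finset.sum_congr rfl fun i _ => by ring
  · push_cast
    simp [mul_pow, Finset.sum_neg_distrib]

instance : IsProbabilityMeasure (gaussMeasure K) := by
  have : IsFiniteMeasure (gaussMeasure K) :=
    isFiniteMeasure_withDensity_ofReal (gaussSchwartz K).integrable.2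
  have total_mass := charFunDual_gaussMeasure (K := K) 0
  rw [charFunDual_apply] at total_mass
  refine ⟨(ENNReal.toReal_eq_one_iff _).1 ?_⟩
  simpa [measureReal_def] using congrArg Complex.re total_mass

lemma ae_gaussMeasure_apply_ne_zero {l : (K → ℝ) →ₗ[ℝ] ℝ} (hl : l ≠ 0) :
    ∀ᵐ u ∂gaussMeasure K, l u ≠ 0 := by
  have null : volume (LinearMap.ker l : Set (K → ℝ)) = 0 :=
    Measure.addHaar_submodule volume _ (by rwa [Ne, LinearMap.ker_eq_top])
  have hne : ∀ᵐ u : K → ℝ, l u ≠ 0 := by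
    rw [ae_iff]
    convert null using 2
    ext u
    simp
  exact (withDensity_absolutelyContinuous _ _).ae_le hne

/-- The characteristic function of the Gaussian measure is rotation invariant. -/
lemma map_mulVec_gaussMeasure {O : Matrix J K ℝ} (hO : O * Oᵀ = 1) :
    (gaussMeasure K).map (fun u => O *ᵥ u) = gaussMeasure J := by
  have hcl : (fun u : K → ℝ => O *ᵥ u) = LinearMap.toContinuousLinearMap O.mulVecLin := by
    ext; simp
  have : IsProbabilityMeasure ((gaussMeasure K).map fun u => O *ᵥ u) := by
    rw [hcl]
    exact Measure.isProbabilityMeasure_map (by fun_prop)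
  refine Measure.ext_of_charFunDual (funext fun L => ?_)
  set l : J → ℝ := fun j => L (Pi.single j 1) with hl
  have pullback : ∀ k, L.comp (LinearMap.toContinuousLinearMap O.mulVecLin) (Pi.single k 1) =
      (Oᵀ *ᵥ l) k := fun k => by
    rw [ContinuousLinearMap.comp_apply, dual_apply_eq_sum L]
    simp [hl, Matrix.mulVec, dotProduct, Pi.single_apply]
  have isometry : ∑ k, (Oᵀ *ᵥ l) k ^ 2 = ∑ j, l j ^ 2 :=
    calc ∑ k, (Oᵀ *ᵥ l) k ^ 2 = (Oᵀ *ᵥ l) ⬝ᵥ (Oᵀ *ᵥ l) := by simp only [dotProduct, sq]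
      _ = l ⬝ᵥ l := by
        rw [Matrix.dotProduct_mulVec, Matrix.vecMul_transpose, Matrix.mulVec_mulVec, hO,
          Matrix.one_mulVec]
      _ = ∑ j, l j ^ 2 := by simp only [dotProduct, sq]
  rw [hcl, charFunDual_map, charFunDual_gaussMeasure, charFunDual_gaussMeasure]
  simp only [pullback, isometry]
  rfl

end Gauss

/-! ### Smoothing of bounded functions -/

section Smoothing

universe w

variable {E F : Type w} [NormedAddCommGroup E] [NormedSpace ℝ E] [FiniteDimensional ℝ E]
  [NormedAddCommGroup F] [NormedSpace ℝ F]

omit [FiniteDimensional ℝ E] in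
lemma exists_norm_schwartz_le (φ : 𝓢(E, F)) (r : ℕ) :
    ∃ C, 0 ≤ C ∧ ∀ x, ‖φ x‖ ≤ C * (1 + ‖x‖) ^ (-(r : ℝ)) := by
  refine ⟨2 ^ r * ((Finset.Iic (r, 0)).sup fun m => SchwartzMap.seminorm ℝ m.1 m.2) φ,
    by positivity, fun x => ?_⟩
  have h := SchwartzMap.one_add_le_sup_seminorm_apply (𝕜 := ℝ) (m := (r, 0)) le_rfl le_rfl φ x
  rw [norm_iteratedFDeriv_zero] at h
  have hpos : 0 < 1 + ‖x‖ := by positivity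
  rwa [Real.rpow_neg hpos.le, Real.rpow_natCast, ← div_eq_mul_inv, le_div_iff₀ (by positivity),
    mul_comm]

variable [MeasurableSpace E] [BorelSpace E] {μ : Measure E} [μ.IsAddHaarMeasure]

lemma exists_integrable_bound_schwartz_sub (φ : 𝓢(E, F)) (u₀ : E) : ∃ g : E → ℝ,
    Integrable g μ ∧ ∀ w, ∀ u ∈ Metric.ball u₀ 1, ‖φ (u - w)‖ ≤ g w := by
  set r : ℕ := Module.finrank ℝ E + 1
  obtain ⟨C, hC, hle⟩ := exists_norm_schwartz_le φ r
  refine ⟨fun w => C * (2 ^ (r : ℝ) * (1 + ‖u₀ - w‖) ^ (-(r : ℝ))), ?_, fun w u hu => ?_⟩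
  · refine Integrable.const_mul (Integrable.const_mul ?_ _) _
    exact (integrable_one_add_norm (μ := μ) (r := r) (by simp [r])).comp_sub_left u₀
  have norm_lt : ‖u₀ - w‖ ≤ ‖u - w‖ + 1 := by
    rw [mem_ball_iff_norm'] at hu
    linarith [norm_sub_le_norm_sub_add_norm_sub u₀ u w]
  have half_le : (1 + ‖u₀ - w‖) / 2 ≤ 1 + ‖u - w‖ := by linarith [norm_nonneg (u - w)]
  refine (hle _).trans (mul_le_mul_of_nonneg_left ?_ hC)
  calc (1 + ‖u - w‖) ^ (-(r : ℝ)) ≤ ((1 + ‖u₀ - w‖) / 2) ^ (-(r : ℝ)) :=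
        Real.rpow_le_rpow_of_nonpos (by positivity) half_le (neg_nonpos.2 (Nat.cast_nonneg _))
    _ = 2 ^ (r : ℝ) * (1 + ‖u₀ - w‖) ^ (-(r : ℝ)) := by
        rw [Real.div_rpow (by positivity) (by norm_num), Real.rpow_neg zero_le_two, div_inv_eq_mul,
          mul_comm]

variable (μ) in
/-- The convolution of a bounded function `s` with a Schwartz function `φ`. -/
def smoothing (s : E → ℝ) (φ : 𝓢(E, F)) (u : E) : F := ∫ w, s w • φ (u - w) ∂μ

variable {s : E → ℝ} {M : ℝ} (hs : Measurable s) (hsM : ∀ x, ‖s x‖ ≤ M)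

include hsM

lemma exists_norm_smoothing_le (φ : 𝓢(E, F)) : ∃ C, ∀ u, ‖smoothing μ s φ u‖ ≤ C := by
  refine ⟨∫ w, M * ‖φ w‖ ∂μ, fun u => ?_⟩
  rw [← integral_sub_left_eq_self (fun w => M * ‖φ w‖) μ u]
  refine norm_integral_le_of_norm_le ((φ.integrable.norm.const_mul M).comp_sub_left u)
    (Eventually.of_forall fun w => ?_)
  rw [norm_smul]
  exact mul_le_mul_of_nonneg_right (hsM w) (norm_nonneg _)

include hs

lemma integrable_smul_schwartz_sub (φ : 𝓢(E, F)) (u : E) :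
    Integrable (fun w => s w • φ (u - w)) μ :=
  (φ.integrable.comp_sub_left u).bdd_smul M hs.aestronglyMeasurable (Eventually.of_forall hsM)

lemma hasFDerivAt_smoothing (φ : 𝓢(E, F)) (u : E) :
    HasFDerivAt (smoothing μ s φ) (smoothing μ s (SchwartzMap.fderivCLM ℝ E F φ) u) u := by
  obtain ⟨g, hg, hle⟩ :=
    exists_integrable_bound_schwartz_sub (μ := μ) (SchwartzMap.fderivCLM ℝ E F φ) u
  refine hasFDerivAt_integral_of_dominated_of_fderiv_le (𝕜 := ℝ) (bound := fun w => M * g w)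
    (F' := fun v w => s w • SchwartzMap.fderivCLM ℝ E F φ (v - w))
    (Metric.ball_mem_nhds u one_pos)
    (Eventually.of_forall fun v => (integrable_smul_schwartz_sub hs hsM φ v).1)
    (integrable_smul_schwartz_sub hs hsM φ u) (integrable_smul_schwartz_sub hs hsM _ u).1
    (Eventually.of_forall fun w v hv => ?_) (hg.const_mul M)
    (Eventually.of_forall fun w v _ => ?_)
  · rw [norm_smul]
    exact mul_le_mul (hsM w) (hle w v hv) (norm_nonneg _) ((norm_nonneg _).trans (hsM w))
  · rw [SchwartzMap.fderivCLM_apply]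
    exact ((hasFDerivAt_comp_sub w).2 φ.differentiableAt.hasFDerivAt).const_smul (s w)

lemma fderiv_smoothing (φ : 𝓢(E, F)) :
    fderiv ℝ (smoothing μ s φ) = smoothing μ s (SchwartzMap.fderivCLM ℝ E F φ) :=
  funext fun u => (hasFDerivAt_smoothing hs hsM φ u).fderiv

lemma contDiff_smoothing (φ : 𝓢(E, F)) : ContDiff ℝ ∞ (smoothing μ s φ) := by
  refine contDiff_infty.2 fun k => ?_
  induction k generalizing F with
  | zero =>
    exact contDiff_zero.2 (continuous_iff_continuousAt.2 fun u =>
      (hasFDerivAt_smoothing hs hsM φ u).continuousAt)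
  | succ k ih =>
    rw [Nat.cast_succ, contDiff_succ_iff_fderiv, fderiv_smoothing hs hsM]
    exact ⟨fun u => (hasFDerivAt_smoothing hs hsM φ u).differentiableAt, by simp, ih _⟩

lemma exists_norm_iteratedFDeriv_smoothing_le (k : ℕ) (φ : 𝓢(E, F)) :
    ∃ C, ∀ u, ‖iteratedFDeriv ℝ k (smoothing μ s φ) u‖ ≤ C := by
  induction k generalizing F with
  | zero => simpa only [norm_iteratedFDeriv_zero] using exists_norm_smoothing_le hsM φ
  | succ k ih =>
    simp only [← norm_iteratedFDeriv_fderiv, fderiv_smoothing hs hsM]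
    exact ih _

end Smoothing

section Signs

lemma measurable_sign : Measurable Real.sign :=
  Measurable.ite measurableSet_Iio measurable_const
    (Measurable.ite measurableSet_Ioi measurable_const measurable_const)

lemma norm_prod_sign_le_one {ι : Type*} (s : Finset ι) (f : ι → ℝ) :
    ‖∏ i ∈ s, Real.sign (f i)‖ ≤ 1 := by
  rw [norm_prod]
  refine Finset.prod_le_one (fun _ _ => norm_nonneg _) fun i _ => ?_
  rcases Real.sign_apply_eq (f i) with h | h | h <;> simp [h]

lemma tendsto_sign_mul_add (a b : ℝ) :
    Tendsto (fun t : ℝ => Real.sign (t * a + b)) atTop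
      (𝓝 (if a = 0 then Real.sign b else Real.sign a)) := by
  split_ifs with ha
  · simp [ha]
  refine tendsto_const_nhds.congr' ?_
  rcases lt_or_gt_of_ne ha with ha | ha
  · filter_upwards [eventually_gt_atTop (-b / a)] with t ht
    rw [div_lt_iff_of_neg ha] at ht
    rw [Real.sign_of_neg ha, Real.sign_of_neg (by linarith)]
  · filter_upwards [eventually_gt_atTop (-b / a)] with t ht
    rw [div_lt_iff₀ ha] at ht
    rw [Real.sign_of_pos ha, Real.sign_of_pos (by linarith)]

lemma sum_mul_prod_zero_mul_prod_sign {E : Type*} [Fintype E] (F : Finset E → ℝ) (a : E → ℝ) :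
    ∑ J : Finset E, F J * (∏ e ∈ J, if a e = 0 then (1 : ℝ) else 0) * ∏ e ∈ Jᶜ, Real.sign (a e) =
      F {e | a e = 0} * ∏ e with a e ≠ 0, Real.sign (a e) := by
  rw [Finset.sum_eq_single ({e | a e = 0} : Finset E) ?_ (by simp)]
  · rw [Finset.prod_eq_one fun e he => if_pos (Finset.mem_filter.1 he).2, mul_one,
      Finset.compl_filter]
  · intro J _ hJ
    rw [mul_assoc, mul_eq_zero]
    right
    contrapose! hJ
    rw [mul_ne_zero_iff, Finset.prod_ne_zero_iff, Finset.prod_ne_zero_iff] at hJ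
    ext e
    by_cases he : e ∈ J
    · simpa [he] using hJ.1 e he
    · simpa [he, Real.sign_eq_zero_iff] using hJ.2 e (Finset.mem_compl.2 he)

end Signs

/-! ### Orthonormal frames -/

section Frames

variable {E K W : Type*} [AddCommGroup W] [Module ℝ W] {β : LinearMap.BilinForm ℝ W}

/-- The family `g` is orthonormal with respect to the form `β`, which need not be definite. -/
def OrthonormalFor (β : LinearMap.BilinForm ℝ W) (g : K → W) : Prop :=
  ∀ i j, β (g i) (g j) = if i = j then 1 else 0

/-- The vectors `v e` are independent and span a positive definite subspace: the condition under
which their boosted error function is defined. -/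
def PosIndep (β : LinearMap.BilinForm ℝ W) (v : E → W) : Prop :=
  LinearIndependent ℝ v ∧ ∀ w ∈ Submodule.span ℝ (Set.range v), w ≠ 0 → 0 < β w w

lemma PosIndep.of_forall_sum [Fintype E] {v : E → W}
    (h : ∀ c : E → ℝ, c ≠ 0 → 0 < β (∑ e, c e • v e) (∑ e, c e • v e)) : PosIndep β v := by
  refine ⟨Fintype.linearIndependent_iff.2 fun c hc => congrFun ?_, fun w hw hw0 => ?_⟩
  · by_contra hne
    simpa [hc] using h c hne
  · obtain ⟨c, rfl⟩ := (Submodule.mem_span_range_iff_exists_fun ℝ).1 hw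
    exact h c fun hc => hw0 (by simp [hc])

lemma PosIndep.comp {v : E → W} (hv : PosIndep β v) {f : K → E} (hf : Function.Injective f) :
    PosIndep β fun k => v (f k) :=
  ⟨hv.1.comp f hf, fun w hw => hv.2 w (Submodule.span_mono (Set.range_comp_subset_range f v) hw)⟩

lemma exists_orthonormalFor_of_posDef {V : Type*} [AddCommGroup V] [Module ℝ V]
    [FiniteDimensional ℝ V] {β : LinearMap.BilinForm ℝ V} (hβ : β.IsSymm)
    (hpos : ∀ w, w ≠ 0 → 0 < β w w) :
    ∃ b : Module.Basis (Fin (Module.finrank ℝ V)) ℝ V, OrthonormalFor β b := by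
  let core : InnerProductSpace.Core ℝ V :=
    { inner := fun x y => β x y
      conj_inner_symm := fun x y => hβ.eq y x
      re_inner_nonneg := fun x => by
        rcases eq_or_ne x 0 with rfl | hx
        · simp
        · exact (hpos x hx).le
      add_left := fun x y z => by simp
      smul_left := fun x y r => by simp
      definite := fun x hx => by
        by_contra hne
        exact (hpos x hne).ne' hx }
  let _ : NormedAddCommGroup V := core.toNormedAddCommGroup
  let _ : InnerProductSpace ℝ V := InnerProductSpace.ofCore core.toCore
  let b := stdOrthonormalBasis ℝ V
  refine ⟨b.toBasis, fun i j => ?_⟩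
  rw [b.coe_toBasis]
  exact (orthonormal_iff_ite.1 b.orthonormal i j).trans (by congr)

lemma PosIndep.exists_frame {E W : Type} [AddCommGroup W] [Module ℝ W] [Finite E]
    {β : LinearMap.BilinForm ℝ W} (hβ : β.IsSymm) {v : E → W} (hv : PosIndep β v) :
    ∃ f : E → W, IsOrthonormalFrame (fun x y => β x y) v f := by
  have := Fintype.ofFinite E
  set S := Submodule.span ℝ (Set.range v)
  have : FiniteDimensional ℝ S := FiniteDimensional.span_of_finite ℝ (Set.finite_range v)
  have hS : Module.finrank ℝ S = Fintype.card E := finrank_span_eq_card hv.1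
  obtain ⟨b, hb⟩ := exists_orthonormalFor_of_posDef (β := β.restrict S) ⟨fun x y => hβ.eq x y⟩
    fun w hw => hv.2 w w.2 (by simpa using hw)
  let r : Fin (Module.finrank ℝ S) ≃ E := (finCongr hS).trans (Fintype.equivFin E).symm
  let b' := b.reindex r
  refine ⟨fun e => b' e, fun i j => ?_, ?_⟩
  · simpa [b', r] using hb (r.symm i) (r.symm j)
  · have hspan := congrArg (Submodule.map S.subtype) b'.span_eq
    rwa [Submodule.map_span, ← Set.range_comp, Submodule.map_subtype_top] at hspan

variable [Fintype K] {g : K → W}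

lemma OrthonormalFor.sum_smul_eq (hg : OrthonormalFor β g) {w : W}
    (hw : w ∈ Submodule.span ℝ (Set.range g)) : ∑ k, β (g k) w • g k = w := by
  obtain ⟨a, rfl⟩ := (Submodule.mem_span_range_iff_exists_fun ℝ).1 hw
  simp [hg _ _]

lemma OrthonormalFor.sum_mul_eq (hg : OrthonormalFor β g) {w : W}
    (hw : w ∈ Submodule.span ℝ (Set.range g)) (y : W) :
    ∑ k, β (g k) w * β (g k) y = β w y := by
  conv_rhs => rw [← hg.sum_smul_eq hw]
  simp

lemma OrthonormalFor.transition_mul_transpose {f : E → W}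
    (hf : OrthonormalFor β f) (hg : OrthonormalFor β g)
    (hfg : ∀ e, f e ∈ Submodule.span ℝ (Set.range g)) :
    let O : Matrix E K ℝ := Matrix.of fun e k => β (g k) (f e)
    O * Oᵀ = 1 := by
  intro O
  ext e e'
  rw [Matrix.one_apply, ← hf e e', Matrix.mul_apply, ← hg.sum_mul_eq (hfg e)]
  rfl

lemma OrthonormalFor.ae_apply_ne_zero (hg : OrthonormalFor β g) {w : W}
    (hw : w ∈ Submodule.span ℝ (Set.range g)) (hw0 : w ≠ 0) :
    ∀ᵐ u ∂gaussMeasure K, β w (∑ k, u k • g k) ≠ 0 := by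
  refine ae_gaussMeasure_apply_ne_zero (l := β w ∘ₗ Fintype.linearCombination ℝ g) fun h => hw0 ?_
  obtain ⟨a, rfl⟩ := (Submodule.mem_span_range_iff_exists_fun ℝ).1 hw
  refine Finset.sum_eq_zero fun k _ => ?_
  have hk : a k = 0 := by
    simpa [hg _ _, Fintype.linearCombination_apply_single] using
      LinearMap.congr_fun h (Pi.single k 1)
  rw [hk, zero_smul]

end Frames

/-! ### Boosted error functions -/

section BoostedErr

variable {E K W : Type} [Fintype E] [Fintype K] [AddCommGroup W] [Module ℝ W]
  {β : LinearMap.BilinForm ℝ W} {v : E → W} {g : K → W}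

lemma genErr_eq_integral (M : Matrix E E ℝ) (u : E → ℝ) :
    genErr M u = ∫ w, ∏ i, Real.sign ((Mᵀ *ᵥ (u + w)) i) ∂gaussMeasure E := by
  rw [integral_gaussMeasure, genErr,
    ← integral_add_left_eq_self (fun u' : E → ℝ => Real.exp _ * _) u]
  simp only [Pi.add_apply, sub_add_cancel_left, neg_sq, smul_eq_mul]

lemma measurable_prod_sign_linear (β : LinearMap.BilinForm ℝ W) (v : E → W) (g : K → W) (x : W) :
    Measurable fun u : K → ℝ => ∏ e, Real.sign (β (v e) (x + ∑ k, u k • g k)) := by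
  refine Finset.measurable_prod _ fun e _ => measurable_sign.comp ?_
  simp only [map_add, map_sum, map_smul, smul_eq_mul]
  fun_prop

lemma integrable_prod_sign_linear (β : LinearMap.BilinForm ℝ W) (v : E → W) (g : K → W) :
    Integrable (fun u : K → ℝ => ∏ e, Real.sign (β (v e) (∑ k, u k • g k))) (gaussMeasure K) := by
  have measurable := measurable_prod_sign_linear β v g 0
  simp only [zero_add] at measurable
  exact .of_bound measurable.aestronglyMeasurable 1 (.of_forall fun u => norm_prod_sign_le_one _ _)

/-- The Gaussian measure on the span of `g` restricts to the one on the span of the frame defining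
the error function, because the change of frames is a coisometry. -/
lemma boostedErr_eq_integral (hβ : β.IsSymm) (hv : PosIndep β v) (hg : OrthonormalFor β g)
    (hvg : ∀ e, v e ∈ Submodule.span ℝ (Set.range g)) (x : W) :
    boostedErr (fun x y => β x y) v x =
      ∫ u, ∏ e, Real.sign (β (v e) (x + ∑ k, u k • g k)) ∂gaussMeasure K := by
  have frame := hv.exists_frame hβ
  rw [boostedErr, dif_pos frame, genErr_eq_integral]
  obtain ⟨hf, hspan⟩ := frame.choose_spec
  set f := frame.choose
  replace hf : OrthonormalFor β f := hf
  have hfg : ∀ k, f k ∈ Submodule.span ℝ (Set.range g) := fun k =>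
    Submodule.span_le.2 (Set.range_subset_iff.2 hvg) (hspan ▸ Submodule.subset_span ⟨k, rfl⟩)
  have hvf : ∀ e, v e ∈ Submodule.span ℝ (Set.range f) := fun e =>
    hspan ▸ Submodule.subset_span ⟨e, rfl⟩
  rw [← map_mulVec_gaussMeasure (hf.transition_mul_transpose hg hfg), integral_map]
  · refine integral_congr_ae (Eventually.of_forall fun u => Finset.prod_congr rfl fun e _ => ?_)
    have coord : ∀ k, β (f k) x + ∑ j, β (g j) (f k) * u j = β (f k) (x + ∑ j, u j • g j) :=
      fun k => by simp [mul_comm, hβ.eq (g _) (f k)]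
    simp [← hf.sum_mul_eq (hvf e), Matrix.mulVec, dotProduct, ← coord]
  · exact Measurable.aemeasurable (by fun_prop)
  · exact (Finset.measurable_prod _ fun i _ =>
      measurable_sign.comp (by fun_prop)).aestronglyMeasurable

lemma boostedErr_zero_eq_integral (hβ : β.IsSymm) (hv : PosIndep β v) (hg : OrthonormalFor β g)
    (hvg : ∀ e, v e ∈ Submodule.span ℝ (Set.range g)) :
    boostedErr (fun x y => β x y) v 0 =
      ∫ u, ∏ e, Real.sign (β (v e) (∑ k, u k • g k)) ∂gaussMeasure K := by
  simpa only [zero_add] using boostedErr_eq_integral hβ hv hg hvg 0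

/-- Along a ray the signs of the nonzero products stabilize, while the factors with `β (v e) ξ = 0`
keep fluctuating and average to an error function at the origin. -/
lemma tendsto_boostedErr_smul (hβ : β.IsSymm) (hv : PosIndep β v) (ξ : W) :
    Tendsto (fun t : ℝ => boostedErr (fun x y => β x y) v (t • ξ)) atTop
      (𝓝 (∑ J : Finset E, boostedErr (fun x y => β x y) (fun e : J => v e) 0 *
        (∏ e ∈ J, if β (v e) ξ = 0 then (1 : ℝ) else 0) *
        ∏ e ∈ Jᶜ, Real.sign (β (v e) ξ))) := by
  obtain ⟨g, hg, hspan⟩ := hv.exists_frame hβ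
  replace hg : OrthonormalFor β g := hg
  have hvg : ∀ e, v e ∈ Submodule.span ℝ (Set.range g) := fun e =>
    hspan ▸ Submodule.subset_span ⟨e, rfl⟩
  rw [sum_mul_prod_zero_mul_prod_sign
      (fun J : Finset E => boostedErr (fun x y => β x y) (fun e : J => v e) 0),
    boostedErr_zero_eq_integral hβ (hv.comp Subtype.val_injective) hg fun e => hvg e,
    ← integral_mul_const]
  simp only [boostedErr_eq_integral hβ hv hg hvg]
  refine tendsto_integral_filter_of_dominated_convergence (fun _ => 1)
    (Eventually.of_forall fun t => (measurable_prod_sign_linear β v g _).aestronglyMeasurable)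
    (Eventually.of_forall fun t => Eventually.of_forall fun u => norm_prod_sign_le_one _ _)
    (by simp) (Eventually.of_forall fun u => ?_)
  have limit_eq : (∏ e : ({e | β (v e) ξ = 0} : Finset E),
        Real.sign (β (v e) (∑ k, u k • g k))) * ∏ e with β (v e) ξ ≠ 0, Real.sign (β (v e) ξ) =
      ∏ e, if β (v e) ξ = 0 then Real.sign (β (v e) (∑ k, u k • g k))
        else Real.sign (β (v e) ξ) := by
    rw [Finset.prod_ite, Finset.prod_coe_sort _ fun e => Real.sign (β (v e) (∑ k, u k • g k))]
  rw [limit_eq]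
  refine tendsto_finsetProd _ fun e _ => ?_
  simpa only [map_add, map_smul, smul_eq_mul] using tendsto_sign_mul_add _ _

end BoostedErr

/-! ### Leading behaviour along a ray -/

section Leading

variable {W : Type*} [NormedAddCommGroup W] [NormedSpace ℝ W] {N M : ℕ} {f g : W → ℝ}

/-- Smooth functions all of whose derivatives are `O((1 + ‖x‖) ^ N)`: unlike plain polynomial
growth, this bound of order `N` is preserved by differentiation. -/
def ModerateGrowth (N : ℕ) (f : W → ℝ) : Prop :=
  ContDiff ℝ ∞ f ∧ ∀ k, iteratedFDeriv ℝ k f =O[⊤] fun x => (1 + ‖x‖) ^ N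

namespace ModerateGrowth

lemma mono (h : N ≤ M) (hf : ModerateGrowth N f) : ModerateGrowth M f :=
  ⟨hf.1, fun k => (hf.2 k).trans <| Asymptotics.isBigO_top.2 ⟨1, fun x => by
    rw [one_mul, norm_pow, norm_pow, Real.norm_of_nonneg (by positivity)]
    exact pow_le_pow_right₀ (by simp) h⟩⟩

lemma add (hf : ModerateGrowth N f) (hg : ModerateGrowth N g) :
    ModerateGrowth N fun x => f x + g x := by
  refine ⟨hf.1.add hg.1, fun k => ?_⟩
  have hk : (k : ℕ∞ω) ≤ ∞ := by exact_mod_cast le_top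
  rw [fun_iteratedFDeriv_add (hf.1.of_le hk) (hg.1.of_le hk)]
  exact (hf.2 k).add (hg.2 k)

lemma const_mul (hf : ModerateGrowth N f) (c : ℝ) : ModerateGrowth N fun x => c * f x := by
  refine ⟨contDiff_const.mul hf.1, fun k => ?_⟩
  have hk : (k : ℕ∞ω) ≤ ∞ := by exact_mod_cast le_top
  have deriv_eq : iteratedFDeriv ℝ k (fun x => c * f x) = fun x => c • iteratedFDeriv ℝ k f x :=
    funext fun _ => iteratedFDeriv_const_smul_apply (a := c) (hf.1.of_le hk).contDiffAt
  rw [deriv_eq]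
  exact (hf.2 k).const_smul_left c

lemma zero (N : ℕ) : ModerateGrowth N fun _ : W => (0 : ℝ) :=
  ⟨contDiff_const, fun k => Asymptotics.isBigO_top.2 ⟨0, fun x => by simp⟩⟩

lemma fderiv_apply (hf : ModerateGrowth N f) (v : W) :
    ModerateGrowth N fun x => fderiv ℝ f x v := by
  have hd : ContDiff ℝ ∞ (fderiv ℝ f) := hf.1.fderiv_right (by simp)
  refine ⟨hd.clm_apply contDiff_const, fun k => (Asymptotics.isBigO_top.2 ⟨‖v‖, fun x => ?_⟩).trans
    (hf.2 (k + 1))⟩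
  rw [← norm_iteratedFDeriv_fderiv]
  exact norm_iteratedFDeriv_clm_apply_const (N := ∞) hd.contDiffAt (by exact_mod_cast le_top)

lemma of_linear (l : W →L[ℝ] ℝ) : ModerateGrowth 1 l := by
  refine ⟨l.contDiff, fun k => Asymptotics.isBigO_top.2 ⟨‖l‖, fun x => ?_⟩⟩
  rw [pow_one, Real.norm_of_nonneg (by positivity)]
  rcases k with _ | _ | k
  · rw [norm_iteratedFDeriv_zero]
    exact (l.le_opNorm x).trans (by gcongr; linarith)
  · rw [← norm_iteratedFDeriv_fderiv, norm_iteratedFDeriv_zero, l.fderiv]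
    exact le_mul_of_one_le_right (norm_nonneg l) (by simp)
  · rw [← norm_iteratedFDeriv_fderiv, show fderiv ℝ l = fun _ => l from funext fun _ => l.fderiv,
      iteratedFDeriv_const_of_ne (by omega), Pi.zero_apply, norm_zero]
    positivity

lemma mul (hf : ModerateGrowth N f) (hg : ModerateGrowth M g) :
    ModerateGrowth (N + M) fun x => f x * g x := by
  refine ⟨hf.1.mul hg.1, fun k => ?_⟩
  have leibniz : iteratedFDeriv ℝ k (fun x => f x * g x) =O[⊤] fun x =>
      ∑ i ∈ Finset.range (k + 1),
        k.choose i * ‖iteratedFDeriv ℝ i f x‖ * ‖iteratedFDeriv ℝ (k - i) g x‖ :=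
    Asymptotics.isBigO_top.2 ⟨1, fun x => by
      rw [one_mul, Real.norm_of_nonneg (by positivity)]
      exact norm_iteratedFDeriv_mul_le (N := ∞) hf.1 hg.1 x (by exact_mod_cast le_top)⟩
  refine leibniz.trans (Asymptotics.IsBigO.fun_sum fun i _ => ?_)
  simp only [pow_add, mul_assoc]
  exact ((hf.2 i).norm_left.mul (hg.2 (k - i)).norm_left).const_mul_left _

lemma tendsto (hf : ModerateGrowth N f) (ξ : W) :
    Tendsto (fun t : ℝ => f (t • ξ) / t ^ (N + 1)) atTop (𝓝 0) := by
  obtain ⟨C, hC⟩ := Asymptotics.isBigO_top.1 (hf.2 0)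
  simp only [norm_iteratedFDeriv_zero, norm_pow] at hC
  refine squeeze_zero_norm' (a := fun t : ℝ => C * (1 + ‖ξ‖) ^ N / t) ?_
    (tendsto_const_nhds.div_atTop tendsto_id)
  filter_upwards [eventually_ge_atTop 1] with t ht
  have hC0 : 0 ≤ C := by simpa using (norm_nonneg _).trans (hC 0)
  have ht0 : 0 < t := by linarith
  have norm_le : ‖1 + ‖t • ξ‖‖ ≤ (1 + ‖ξ‖) * t := by
    rw [Real.norm_of_nonneg (by positivity), norm_smul, Real.norm_of_nonneg ht0.le]
    linarith
  rw [norm_div, norm_pow, Real.norm_of_nonneg ht0.le, pow_succ, ← div_div]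
  gcongr
  rw [div_le_iff₀ (by positivity), mul_assoc, ← mul_pow]
  exact (hC (t • ξ)).trans (by gcongr)

end ModerateGrowth

/-- `f` has order `N`, with all its derivatives, and leading coefficient `A` along the ray through
`ξ`. -/
def HasLeading (ξ : W) (N : ℕ) (f : W → ℝ) (A : ℝ) : Prop :=
  ModerateGrowth N f ∧ Tendsto (fun t : ℝ => f (t • ξ) / t ^ N) atTop (𝓝 A)

namespace HasLeading

variable {ξ : W} {A B : ℝ}

lemma add (hf : HasLeading ξ N f A) (hg : HasLeading ξ N g B) :
    HasLeading ξ N (fun x => f x + g x) (A + B) :=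
  ⟨hf.1.add hg.1, by simpa only [add_div] using hf.2.add hg.2⟩

lemma const_mul (hf : HasLeading ξ N f A) (c : ℝ) : HasLeading ξ N (fun x => c * f x) (c * A) :=
  ⟨hf.1.const_mul c, by simpa only [mul_div_assoc] using hf.2.const_mul c⟩

lemma sum {ι : Type*} (s : Finset ι) {f : ι → W → ℝ} {A : ι → ℝ}
    (h : ∀ i ∈ s, HasLeading ξ N (f i) (A i)) :
    HasLeading ξ N (fun x => ∑ i ∈ s, f i x) (∑ i ∈ s, A i) := by
  induction s using Finset.induction_on with
  | empty => exact ⟨ModerateGrowth.zero N, by simp⟩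
  | insert a s ha ih =>
    simp only [Finset.sum_insert ha]
    exact (h a (by simp)).add (ih fun i hi => h i (by simp [hi]))

lemma linear_mul (hf : HasLeading ξ N f A) (l : W →L[ℝ] ℝ) :
    HasLeading ξ (N + 1) (fun x => l x * f x) (l ξ * A) := by
  refine ⟨by simpa only [add_comm] using (ModerateGrowth.of_linear l).mul hf.1,
    (hf.2.const_mul (l ξ)).congr' ?_⟩
  filter_upwards [eventually_gt_atTop 0] with t ht
  rw [map_smul, smul_eq_mul]
  field_simp
  ring

/-- Differentiation does not raise the order, hence only `l` matters to leading order. -/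
lemma linear_mul_add_fderiv (hf : HasLeading ξ N f A) (l : W →L[ℝ] ℝ) (c : ℝ) (v : W) :
    HasLeading ξ (N + 1) (fun x => l x * f x + c * fderiv ℝ f x v) (l ξ * A) := by
  have hd : ModerateGrowth N fun x => c * fderiv ℝ f x v := (hf.1.fderiv_apply v).const_mul c
  simpa only [add_zero] using (hf.linear_mul l).add ⟨hd.mono N.le_succ, hd.tendsto ξ⟩

lemma opProd {W : Type} [NormedAddCommGroup W] [NormedSpace ℝ W] {ξ : W} {f : W → ℝ}
    {E : Type} [Fintype E] {op : E → (W → ℝ) → W → ℝ} {d : E → ℕ} {a : E → ℝ}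
    (hop : ∀ e N f A, HasLeading ξ N f A → HasLeading ξ (N + d e) (op e f) (a e * A))
    (hf : HasLeading ξ N f A) :
    HasLeading ξ (N + ∑ e, d e) (opProd op f) ((∏ e, a e) * A) := by
  have along_list (l : List E) : HasLeading ξ (N + (l.map d).sum)
      ((l.map op).foldr (fun D g => D g) f) ((l.map a).prod * A) := by
    induction l with
    | nil =>
      rw [List.map_nil, List.map_nil, List.map_nil, List.sum_nil, List.prod_nil, add_zero, one_mul]
      exact hf
    | cons e l ih =>
      simp only [List.map_cons, List.sum_cons, List.prod_cons, List.foldr_cons]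
      rw [mul_assoc, add_comm (d e), ← add_assoc]
      exact hop e _ _ _ ih
  rw [← Finset.sum_map_toList, ← Finset.prod_map_toList]
  exact along_list Finset.univ.toList

end HasLeading

variable {E : Type} [Fintype E]

lemma genErr_eq_smoothing (M : Matrix E E ℝ) : genErr M =
    smoothing volume (fun w => ∏ i, Real.sign ((Mᵀ *ᵥ w) i)) (gaussSchwartz E) := by
  ext u
  simp only [genErr, smoothing, gaussSchwartz_apply, Pi.sub_apply, smul_eq_mul, mul_comm]

lemma moderateGrowth_genErr_comp (M : Matrix E E ℝ) (L : W →L[ℝ] (E → ℝ)) :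
    ModerateGrowth 0 fun x => genErr M (L x) := by
  have hs : Measurable fun w : E → ℝ => ∏ i, Real.sign ((Mᵀ *ᵥ w) i) :=
    Finset.measurable_prod _ fun i _ => measurable_sign.comp (by fun_prop)
  rw [genErr_eq_smoothing]
  have smooth := contDiff_smoothing (μ := volume) hs (fun w => norm_prod_sign_le_one _ _)
    (gaussSchwartz E)
  refine ⟨smooth.comp L.contDiff, fun k => ?_⟩
  obtain ⟨C, hC⟩ := exists_norm_iteratedFDeriv_smoothing_le (μ := volume) hs
    (fun w => norm_prod_sign_le_one _ _) k (gaussSchwartz E)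
  refine Asymptotics.isBigO_top.2 ⟨C * ‖L‖ ^ k, fun x => ?_⟩
  rw [pow_zero, norm_one, mul_one]
  calc ‖iteratedFDeriv ℝ k (smoothing _ _ _ ∘ L) x‖
      ≤ ‖iteratedFDeriv ℝ k (smoothing _ _ _) (L x)‖ * ∏ _ : Fin k, ‖L‖ := by
        rw [L.iteratedFDeriv_comp_right smooth x (by exact_mod_cast le_top)]
        exact ContinuousMultilinearMap.norm_compContinuousLinearMap_le _ _
    _ ≤ C * ‖L‖ ^ k := by
        rw [Finset.prod_const, Finset.card_univ, Fintype.card_fin]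
        gcongr
        exact hC _

lemma moderateGrowth_boostedErr {W : Type} [NormedAddCommGroup W] [NormedSpace ℝ W]
    [FiniteDimensional ℝ W] (β : LinearMap.BilinForm ℝ W) (v : E → W) :
    ModerateGrowth 0 (boostedErr (fun x y => β x y) v) := by
  unfold boostedErr
  split_ifs with h
  · exact moderateGrowth_genErr_comp (Matrix.of fun k i => β (h.choose k) (v i))
      (LinearMap.toContinuousLinearMap (LinearMap.pi fun k => β (h.choose k)))
  · exact ModerateGrowth.zero 0

lemma hasLeading_boostedErr {W : Type} [NormedAddCommGroup W] [NormedSpace ℝ W]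
    [FiniteDimensional ℝ W] {β : LinearMap.BilinForm ℝ W} (hβ : β.IsSymm) {v : E → W}
    (hv : PosIndep β v) (ξ : W) :
    HasLeading ξ 0 (boostedErr (fun x y => β x y) v)
      (∑ J : Finset E, boostedErr (fun x y => β x y) (fun e : J => v e) 0 *
        (∏ e ∈ J, if β (v e) ξ = 0 then (1 : ℝ) else 0) *
        ∏ e ∈ Jᶜ, Real.sign (β (v e) ξ)) :=
  ⟨moderateGrowth_boostedErr β v, by
    simpa only [pow_zero, div_one] using tendsto_boostedErr_smul hβ hv ξ⟩

end Leading

/-! ### Intersection forms -/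

section Lorentzian

variable {W : Type*} [AddCommGroup W] [Module ℝ W] [FiniteDimensional ℝ W]
  {β : LinearMap.BilinForm ℝ W}

lemma PosIndep.card_le_sigPos {E : Type*} [Fintype E] {v : E → W} (hv : PosIndep β v) :
    Fintype.card E ≤ sigPos β.toQuadraticMap := by
  rw [← finrank_span_eq_card hv.1]
  exact le_sigPos_of_posDef _ fun w hw => hv.2 w w.2 fun h => hw (Subtype.ext h)

lemma one_le_sigPos_of_pos {x : W} (hx : 0 < β x x) : 1 ≤ sigPos β.toQuadraticMap := by
  have pos : PosIndep β fun _ : Unit => x := .of_forall_sum fun c hc => by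
    have hc : c () ≠ 0 := fun h => hc (funext fun _ => h)
    simpa [← mul_assoc] using mul_pos (mul_self_pos.2 hc) hx
  simpa using pos.card_le_sigPos

/-- The reversed Cauchy-Schwarz inequality: otherwise `x` and `y` would span a positive definite
plane. -/
lemma mul_le_sq_of_sigPos_le_one (hβ : β.IsSymm) (hsig : sigPos β.toQuadraticMap ≤ 1) {x : W}
    (hx : 0 < β x x) (y : W) : β x x * β y y ≤ β x y ^ 2 := by
  by_contra! hlt
  have pos : PosIndep β ![x, y] := .of_forall_sum fun c hc => by
    simp only [Fin.sum_univ_two, Matrix.cons_val_zero, Matrix.cons_val_one, map_add, map_smul,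
      LinearMap.add_apply, LinearMap.smul_apply, smul_eq_mul, hβ.eq y x]
    have complete_square : β x x * (c 0 * (c 0 * β x x + c 1 * β x y) +
        c 1 * (c 0 * β x y + c 1 * β y y)) =
        (c 0 * β x x + c 1 * β x y) ^ 2 + c 1 ^ 2 * (β x x * β y y - β x y ^ 2) := by ring
    refine pos_of_mul_pos_right (a := β x x) ?_ hx.le
    rw [complete_square]
    rcases eq_or_ne (c 1) 0 with h1 | h1
    · have h0 : c 0 ≠ 0 := fun h0 => hc (by ext i; fin_cases i <;> assumption)
      simp only [h1, zero_mul, add_zero, zero_pow two_ne_zero]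
      positivity
    · have := sub_pos.2 hlt
      positivity
  simpa using pos.card_le_sigPos.trans hsig

end Lorentzian

section Cubic

variable {b : ℕ}

/-- The real vector of an integer class. -/
def realVec : (Fin b → ℤ) →+ (Fin b → ℝ) := (Int.castAddHom ℝ).compLeft (Fin b)

/-- The bilinear form `κ_{abc} z^c`, as a linear function of the real class `z`. -/
def tripleForm (κ : Fin b → Fin b → Fin b → ℤ) :
    (Fin b → ℝ) →ₗ[ℝ] LinearMap.BilinForm ℝ (Fin b → ℝ) :=
  (Matrix.toLinearMap₂' ℝ).toLinearMap ∘ₗ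
    { toFun := fun z => Matrix.of fun i j => ∑ k, (κ i j k : ℝ) * z k
      map_add' := fun x y => by ext i j; simp [mul_add, Finset.sum_add_distrib]
      map_smul' := fun c x => by ext i j; simp [Finset.mul_sum, mul_left_comm] }

lemma tripleForm_realVec (κ : Fin b → Fin b → Fin b → ℤ) (p : Fin b → ℤ) :
    tripleForm κ (realVec p) = Matrix.toLinearMap₂' ℝ (kappaMat κ p) :=
  rfl

lemma tripleForm_apply (κ : Fin b → Fin b → Fin b → ℤ) (x y z : Fin b → ℝ) :
    tripleForm κ z x y = ∑ i, ∑ j, ∑ k, (κ i j k : ℝ) * x i * y j * z k := by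
  simp only [tripleForm, LinearMap.coe_comp, Function.comp_apply, LinearMap.coe_mk, AddHom.coe_mk,
    LinearEquiv.coe_coe, Matrix.toLinearMap₂'_apply, Matrix.of_apply, smul_eq_mul, Finset.mul_sum]
  refine Finset.sum_congr rfl fun i _ => Finset.sum_congr rfl fun j _ =>
    Finset.sum_congr rfl fun k _ => ?_
  ring

lemma tripleForm_realVec_apply (κ : Fin b → Fin b → Fin b → ℤ) (p q r : Fin b → ℤ) :
    tripleForm κ (realVec r) (realVec p) (realVec q) = cubic κ p q r := by
  simp [tripleForm_apply, cubic, realVec]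

variable {X : IntersectionData b}

lemma tripleForm_isSymm (z : Fin b → ℝ) : (tripleForm X.κ z).IsSymm := by
  refine ⟨fun x y => ?_⟩
  simp only [tripleForm_apply]
  rw [Finset.sum_comm]
  simp only [X.κ_swap_left, mul_right_comm]

lemma tripleForm_swap (x y z : Fin b → ℝ) : tripleForm X.κ x y z = tripleForm X.κ y x z := by
  rw [(tripleForm_isSymm x).eq, (tripleForm_isSymm y).eq, tripleForm_apply, tripleForm_apply]
  refine Finset.sum_congr rfl fun i _ => ?_
  rw [Finset.sum_comm]
  simp only [X.κ_swap_right i, mul_right_comm]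

lemma hodge_index {p : Fin b → ℤ} (hp : InChargeCone X.κ X.effDiv X.effCurve p) (w : Fin b → ℝ) :
    tripleForm X.κ (realVec p) (realVec p) (realVec p) * tripleForm X.κ (realVec p) w w ≤
      tripleForm X.κ (realVec p) (realVec p) w ^ 2 := by
  have pos : 0 < tripleForm X.κ (realVec p) (realVec p) (realVec p) := by
    rw [tripleForm_realVec_apply]
    exact_mod_cast hp.1
  exact mul_le_sq_of_sigPos_le_one (tripleForm_isSymm _) (X.signature_pos p hp).le pos w

lemma isUnit_det_kappaMat {p : Fin b → ℤ} (hp : InChargeCone X.κ X.effDiv X.effCurve p) :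
    IsUnit (kappaMat X.κ p).det := by
  set Q := (kappaMat X.κ p).toQuadraticForm'
  have radical_eq_bot : Q.radical = ⊥ := by
    have rank := QuadraticForm.sigPos_add_sigNeg_add_radical (Q := Q)
    rw [Module.finrank_fin_fun] at rank
    have sig_pos : sigPos Q = 1 := X.signature_pos p hp
    have sig_neg : sigNeg Q + 1 = b := X.signature_neg p hp
    rw [← Submodule.finrank_eq_zero (R := ℝ)]
    omega
  rw [isUnit_iff_ne_zero]
  intro hdet
  obtain ⟨x, hx0, hx⟩ := Matrix.exists_mulVec_eq_zero_iff.2 hdet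
  have pairing_eq_zero (y : Fin b → ℝ) : tripleForm X.κ (realVec p) y x = 0 := by
    rw [tripleForm_realVec, Matrix.toLinearMap₂'_apply', hx, dotProduct_zero]
  refine hx0 ?_
  rw [← Submodule.mem_bot ℝ, ← radical_eq_bot, QuadraticMap.mem_radical_iff']
  have apply_eq (y : Fin b → ℝ) : Q y = tripleForm X.κ (realVec p) y y := rfl
  refine ⟨pairing_eq_zero x, fun y => ?_⟩
  simp only [apply_eq, map_add, LinearMap.add_apply, pairing_eq_zero,
    (tripleForm_isSymm (X := X) (realVec p)).eq x y, zero_add, add_zero]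

end Cubic

section Form

variable {b n : ℕ} {X : IntersectionData b} (γ : Fin n → Charge X)

/-- The form `x · y` as a bilinear form. -/
def formB : LinearMap.BilinForm ℝ (Fin n → Fin b → ℝ) :=
  ∑ i, (tripleForm X.κ (realVec (γ i).p)).compl₁₂ (LinearMap.proj i) (LinearMap.proj i)

lemma formB_apply (x y : Fin n → Fin b → ℝ) :
    formB γ x y = ∑ i, tripleForm X.κ (realVec (γ i).p) (x i) (y i) := by
  simp [formB, LinearMap.sum_apply]

lemma biform_eq : biform γ = fun x y => formB γ x y := by
  ext x y
  simp only [biform, formB_apply, tripleForm_realVec, Matrix.toLinearMap₂'_apply, smul_eq_mul]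
  refine Finset.sum_congr rfl fun i _ => Finset.sum_congr rfl fun a _ =>
    Finset.sum_congr rfl fun c _ => ?_
  ring

lemma formB_isSymm : (formB γ).IsSymm :=
  ⟨fun x y => by
    simp only [formB_apply]
    exact Finset.sum_congr rfl fun i _ => (tripleForm_isSymm _).eq _ _⟩

/-- The direction `κ_i^{ab} q_{i,b}` of the points `point γ τ₂`. -/
def ray : Fin n → Fin b → ℝ := fun i => (kappaMat X.κ (γ i).p)⁻¹ *ᵥ (γ i).q

lemma formB_ray (x : Fin n → Fin b → ℝ) : formB γ x (ray γ) = ∑ i, x i ⬝ᵥ (γ i).q := by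
  rw [formB_apply]
  refine Finset.sum_congr rfl fun i _ => ?_
  rw [tripleForm_realVec, Matrix.toLinearMap₂'_apply', ray, Matrix.mulVec_mulVec,
    Matrix.mul_nonsing_inv _ (isUnit_det_kappaMat (γ i).p_mem), Matrix.one_mulVec]

lemma formB_vec_ray (i j : Fin n) : formB γ (vec γ i j) (ray γ) = dirac γ i j := by
  simp only [formB_ray, dotProduct]
  rw [Finset.sum_comm]
  simp [dirac, vec, sub_mul, Finset.sum_sub_distrib]

/-- The total D4-brane charge. -/
def totalP : Fin b → ℤ := ∑ i, (γ i).p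

lemma totalP_mem [Nonempty (Fin n)] : InChargeCone X.κ X.effDiv X.effCurve (totalP γ) :=
  Finset.sum_induction_nonempty _ _ X.cone_add Finset.univ_nonempty fun i _ => (γ i).p_mem

/-- The vector with components `∑_j (φ_i - φ_j) p_j`: the vectors `v_e` of trees are of this form,
for indicator functions `φ`. -/
def chi : (Fin n → ℝ) →ₗ[ℝ] (Fin n → Fin b → ℝ) :=
  LinearMap.pi fun i => ∑ j,
    ((LinearMap.proj i : (Fin n → ℝ) →ₗ[ℝ] ℝ) - LinearMap.proj j).smulRight (realVec (γ j).p)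

lemma chi_apply (φ : Fin n → ℝ) (i : Fin n) :
    chi γ φ i = ∑ j, (φ i - φ j) • realVec (γ j).p := by
  simp [chi, LinearMap.sum_apply]

lemma chi_apply' (φ : Fin n → ℝ) (i : Fin n) :
    chi γ φ i = φ i • realVec (totalP γ) - ∑ j, φ j • realVec (γ j).p := by
  simp only [chi_apply, sub_smul, Finset.sum_sub_distrib, totalP, map_sum, Finset.smul_sum]

lemma chi_const (r : ℝ) : chi γ (fun _ => r) = 0 := by
  ext i a
  simp [chi_apply]

lemma formB_chi (φ : Fin n → ℝ) : formB γ (chi γ φ) (chi γ φ) =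
    ∑ i, φ i ^ 2 * tripleForm X.κ (realVec (totalP γ)) (realVec (totalP γ)) (realVec (γ i).p) -
      tripleForm X.κ (realVec (totalP γ)) (∑ j, φ j • realVec (γ j).p)
        (∑ j, φ j • realVec (γ j).p) := by
  set P := realVec (totalP γ) with hP
  set w := ∑ j, φ j • realVec (γ j).p with hw
  have expand (i : Fin n) : tripleForm X.κ (realVec (γ i).p) (chi γ φ i) (chi γ φ i) =
      φ i ^ 2 * tripleForm X.κ P P (realVec (γ i).p) -
        2 * tripleForm X.κ P w (φ i • realVec (γ i).p) +
        tripleForm X.κ w w (realVec (γ i).p) := by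
    simp only [chi_apply', ← hP, ← hw, map_sub, map_smul, LinearMap.sub_apply,
      LinearMap.smul_apply, smul_eq_mul]
    rw [tripleForm_swap (realVec (γ i).p) P P, tripleForm_swap (realVec (γ i).p) P w,
      (tripleForm_isSymm (realVec (γ i).p)).eq w P, tripleForm_swap (realVec (γ i).p) P w,
      tripleForm_swap (realVec (γ i).p) w w, (tripleForm_isSymm P).eq (realVec (γ i).p) P,
      (tripleForm_isSymm P).eq (realVec (γ i).p) w, (tripleForm_isSymm w).eq (realVec (γ i).p) w]
    ring
  have total : P = ∑ i, realVec (γ i).p := by rw [hP, totalP, map_sum]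
  rw [formB_apply, Finset.sum_congr rfl fun i _ => expand i, Finset.sum_add_distrib,
    Finset.sum_sub_distrib, ← Finset.mul_sum, ← map_sum, ← map_sum, ← hw, ← total,
    (tripleForm_isSymm w).eq w P, tripleForm_swap w P w]
  ring

/-- After subtracting a constant from `φ`, the vector `∑ φ_j p_j` is orthogonal to the total charge,
so that the Hodge index theorem applies. -/
lemma formB_chi_pos {φ : Fin n → ℝ} {i₀ j₀ : Fin n} (hφ : φ i₀ ≠ φ j₀) :
    0 < formB γ (chi γ φ) (chi γ φ) := by
  have : Nonempty (Fin n) := ⟨i₀⟩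
  set P := realVec (totalP γ)
  set m : Fin n → ℝ := fun i => tripleForm X.κ P P (realVec (γ i).p) with hm
  have m_pos (i : Fin n) : 0 < m i := by
    have := (totalP_mem γ).2.1 _ (X.cone_effective _ (γ i).p_mem)
    simp only [hm]
    rw [(tripleForm_isSymm P).eq, tripleForm_swap, tripleForm_swap, tripleForm_realVec_apply]
    exact_mod_cast this
  have sum_m_pos : 0 < ∑ i, m i := Finset.sum_pos (fun i _ => m_pos i) Finset.univ_nonempty
  have P_pos : 0 < tripleForm X.κ P P P := by
    rw [tripleForm_realVec_apply]
    exact_mod_cast (totalP_mem γ).1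
  obtain ⟨ψ, hψ, ortho, hne⟩ : ∃ ψ : Fin n → ℝ, chi γ φ = chi γ ψ ∧
      tripleForm X.κ P P (∑ j, ψ j • realVec (γ j).p) = 0 ∧ ψ i₀ ≠ ψ j₀ := by
    refine ⟨φ - fun _ => (∑ i, φ i * m i) / ∑ i, m i, ?_, ?_, ?_⟩
    · rw [map_sub, chi_const, sub_zero]
    · simp only [map_sum, map_smul, smul_eq_mul, Pi.sub_apply]
      change ∑ i, (φ i - _) * m i = 0
      simp only [sub_mul, Finset.sum_sub_distrib, ← Finset.mul_sum]
      rw [div_mul_cancel₀ _ sum_m_pos.ne', sub_self]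
    · simpa using hφ
  have hodge := hodge_index (totalP_mem γ) (∑ j, ψ j • realVec (γ j).p)
  rw [ortho, zero_pow two_ne_zero] at hodge
  have sum_pos : 0 < ∑ i, ψ i ^ 2 * m i := by
    obtain ⟨i, hi⟩ : ∃ i, ψ i ≠ 0 := by
      by_contra! h
      exact hne (by rw [h, h])
    exact Finset.sum_pos' (fun i _ => mul_nonneg (sq_nonneg _) (m_pos i).le)
      ⟨i, Finset.mem_univ i, mul_pos (by positivity) (m_pos i)⟩
  rw [hψ, formB_chi]
  exact sub_pos.2 ((nonpos_of_mul_nonpos_right hodge P_pos).trans_lt sum_pos)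

end Form

/-! ### Trees -/

namespace OGraph

section Linked

variable {V E : Type} {T : OGraph V E} {A A' : Set E} {u v w : V}

namespace Linked

lemma refl (A : Set E) (u : V) : T.Linked A u u := Relation.EqvGen.refl u

lemma symm (h : T.Linked A u v) : T.Linked A v u := Relation.EqvGen.symm _ _ h

lemma trans (h : T.Linked A u v) (h' : T.Linked A v w) : T.Linked A u w :=
  Relation.EqvGen.trans _ _ _ h h'

lemma edge {e : E} (he : e ∈ A) : T.Linked A (T.src e) (T.tgt e) :=
  Relation.EqvGen.rel _ _ ⟨e, he, rfl, rfl⟩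

lemma of_equivalence {r : V → V → Prop} (hr : Equivalence r)
    (h : ∀ e ∈ A, r (T.src e) (T.tgt e)) (huv : T.Linked A u v) : r u v :=
  hr.eqvGen_iff.1 (huv.mono fun _ _ ⟨e, he, hu, hv⟩ => hu ▸ hv ▸ h e he)

lemma eq_of_forall {α : Sort*} {f : V → α} (hf : ∀ e ∈ A, f (T.src e) = f (T.tgt e))
    (h : T.Linked A u v) : f u = f v :=
  h.of_equivalence (r := fun u v => f u = f v) ⟨fun _ => rfl, Eq.symm, Eq.trans⟩ hf

lemma of_edges {V' E' : Type} {T' : OGraph V' E'} {A' : Set E'} (f : V → V')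
    (hf : ∀ e ∈ A, T'.Linked A' (f (T.src e)) (f (T.tgt e))) (h : T.Linked A u v) :
    T'.Linked A' (f u) (f v) :=
  h.of_equivalence (r := fun u v => T'.Linked A' (f u) (f v)) ⟨fun _ => refl _ _, symm, trans⟩ hf

lemma mono (hA : A ⊆ A') (h : T.Linked A u v) : T.Linked A' u v :=
  h.of_edges id fun _ he => .edge (hA he)

end Linked

variable (T) in
/-- `S` is one of the two parts into which the removal of `e` cuts the graph, the one containing the
source of `e`. -/
def Cuts (e : E) (S : Set V) : Prop :=
  T.src e ∈ S ∧ T.tgt e ∉ S ∧ ∀ e', e' ≠ e → (T.src e' ∈ S ↔ T.tgt e' ∈ S)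

lemma cuts_srcSide (hT : T.IsTree) (e : E) : T.Cuts e (T.srcSide e) := by
  refine ⟨.refl _ _, hT.2.2 e, fun e' he' => ?_⟩
  have h : T.Linked {e}ᶜ (T.src e') (T.tgt e') := .edge he'
  exact ⟨fun h' => Linked.trans h' h, fun h' => Linked.trans h' h.symm⟩

lemma Cuts.mem_iff_of_linked {e : E} {S : Set V} (hS : T.Cuts e S) (h : T.Linked {e}ᶜ u v) :
    u ∈ S ↔ v ∈ S :=
  iff_of_eq (h.eq_of_forall (f := (· ∈ S)) fun e' he' => propext (hS.2.2 e' he'))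

lemma not_linked_of_cuts {e : E} {S : Set V} (hS : T.Cuts e S) :
    ¬ T.Linked {e}ᶜ (T.src e) (T.tgt e) :=
  fun h => hS.2.1 ((hS.mem_iff_of_linked h).1 hS.1)

lemma tgtSide_eq_compl (hT : T.IsTree) (e : E) : T.tgtSide e = (T.srcSide e)ᶜ := by
  have union (v : V) : v ∈ T.srcSide e ∪ T.tgtSide e := by
    have invariant : ∀ e' ∈ Set.univ,
        (T.src e' ∈ T.srcSide e ∪ T.tgtSide e) = (T.tgt e' ∈ T.srcSide e ∪ T.tgtSide e) := by
      intro e' _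
      rcases eq_or_ne e' e with rfl | he
      · exact propext (iff_of_true (.inl (.refl _ _)) (.inr (.refl _ _)))
      · have h : T.Linked {e}ᶜ (T.src e') (T.tgt e') := .edge he
        exact propext ⟨Or.imp (fun h' => Linked.trans h' h) fun h' => Linked.trans h' h,
          Or.imp (fun h' => Linked.trans h' h.symm) fun h' => Linked.trans h' h.symm⟩
    rw [← Linked.eq_of_forall (f := (· ∈ T.srcSide e ∪ T.tgtSide e)) invariant
      (hT.2.1 (T.src e) v)]
    exact .inl (.refl _ _)
  ext v
  exact ⟨fun h h' => hT.2.2 e (Linked.trans h' (Linked.symm h)), (union v).resolve_left⟩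

lemma srcSide_eq_of_cuts (hT : T.IsTree) {e : E} {S : Set V} (hS : T.Cuts e S) :
    T.srcSide e = S := by
  refine Set.Subset.antisymm (fun v hv => (hS.mem_iff_of_linked hv).1 hS.1) fun v hv => ?_
  by_contra hn
  have h : v ∈ T.tgtSide e := (tgtSide_eq_compl hT e).symm ▸ hn
  exact hS.2.1 ((hS.mem_iff_of_linked h).2 hv)

lemma contract_linked_iff (J : Finset E) (e : J) (u v : V) :
    (T.contract J).Linked {e}ᶜ (Quotient.mk (T.contractSetoid J) u)
      (Quotient.mk (T.contractSetoid J) v) ↔ T.Linked {e.1}ᶜ u v := by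
  constructor
  · intro h
    have linked_of_rel {x y : V} (hxy : T.Linked {e' | e' ∉ J} x y) : T.Linked {e.1}ᶜ x y :=
      Linked.mono (A := {e' | e' ∉ J}) (fun _ he' h => he' (Set.mem_singleton_iff.1 h ▸ e.2)) hxy
    let reachable : Quotient (T.contractSetoid J) → Prop := Quotient.lift (T.Linked {e.1}ᶜ u)
      fun _ _ hxy => propext ⟨fun h => h.trans (linked_of_rel hxy),
        fun h => h.trans (linked_of_rel hxy).symm⟩
    have edge_iff : ∀ e' ∈ ({e}ᶜ : Set J),
        reachable ((T.contract J).src e') = reachable ((T.contract J).tgt e') := fun e' he' => by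
      have h : T.Linked {e.1}ᶜ (T.src e'.1) (T.tgt e'.1) := .edge fun h => he' (Subtype.ext h)
      exact propext ⟨fun h' => Linked.trans h' h, fun h' => Linked.trans h' h.symm⟩
    exact (h.eq_of_forall edge_iff).mp (Linked.refl _ u)
  · refine Linked.of_edges _ fun e' he' => ?_
    by_cases hJ : e' ∈ J
    · exact .edge (T := T.contract J) (e := ⟨e', hJ⟩) fun h => he' (congrArg Subtype.val h)
    · have h : Quotient.mk (T.contractSetoid J) (T.src e') =
          Quotient.mk (T.contractSetoid J) (T.tgt e') :=
        Quotient.sound (Linked.edge (A := {e | e ∉ J}) hJ)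
      rw [h]
      exact .refl _ _

end Linked

section Potential

variable {V E : Type} [Fintype E] {T : OGraph V E}

variable (T) in
/-- The function on the vertices which drops by `a e` along each edge `e` of a tree, written in
terms of the parts cut off by the edges. -/
def potential (a : E → ℝ) : V → ℝ := ∑ e, a e • (T.srcSide e).indicator 1

lemma potential_src_sub_tgt (hT : T.IsTree) (a : E → ℝ) (e : E) :
    T.potential a (T.src e) - T.potential a (T.tgt e) = a e := by
  simp only [potential, Finset.sum_apply, Pi.smul_apply, smul_eq_mul, ← Finset.sum_sub_distrib,
    Set.indicator_apply, Pi.one_apply]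
  rw [Finset.sum_eq_single e (fun e' _ hne => ?_) (by simp)]
  · simp [(cuts_srcSide hT e).1, (cuts_srcSide hT e).2.1]
  · simp [(cuts_srcSide hT e').2.2 e hne.symm]

lemma eq_potential_add_const (hT : T.IsTree) (φ : V → ℝ) :
    ∃ r : ℝ, ∀ v, φ v = T.potential (fun e => φ (T.src e) - φ (T.tgt e)) v + r := by
  obtain ⟨v₀⟩ := hT.1
  set a : E → ℝ := fun e => φ (T.src e) - φ (T.tgt e)
  refine ⟨φ v₀ - T.potential a v₀, fun v => ?_⟩
  have := Linked.eq_of_forall (f := fun v => φ v - T.potential a v)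
    (fun e _ => by linarith [potential_src_sub_tgt hT a e]) (hT.2.1 v v₀)
  linarith

end Potential

section Vectors

variable {V E : Type} {T : OGraph V E} {b n : ℕ} {X : IntersectionData b} (γ : Fin n → Charge X)
  (c : Fin n → V)

lemma sum_vec_eq_chi (S : Set (Fin n)) :
    ∑ i with i ∈ S, ∑ j with j ∉ S, vec γ i j = chi γ (S.indicator 1) := by
  ext k a
  have vec_apply (i j : Fin n) : vec γ i j k a =
    (if k = i then realVec (γ j).p a else 0) - if k = j then realVec (γ i).p a else 0 := rfl
  simp only [chi_apply, Finset.sum_apply, vec_apply, Finset.sum_sub_distrib, Pi.smul_apply,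
    smul_eq_mul, Set.indicator_apply, Pi.one_apply]
  rw [Finset.sum_comm (s := Finset.univ.filter (· ∈ S))]
  simp only [Finset.sum_ite_eq, Finset.mem_filter_univ]
  by_cases hk : k ∈ S
  · simp only [hk, if_true, not_true_eq_false, if_false, Finset.sum_const_zero, sub_zero,
      Finset.sum_filter]
    exact Finset.sum_congr rfl fun j _ => by split_ifs <;> simp
  · simp only [hk, if_false, not_false_eq_true, if_true, Finset.sum_const_zero, zero_sub,
      Finset.sum_filter, ← Finset.sum_neg_distrib]
    exact Finset.sum_congr rfl fun j _ => by split_ifs <;> simp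

lemma edgeVec_eq_chi (hT : T.IsTree) (e : E) :
    T.edgeVec γ c e = chi γ ((c ⁻¹' T.srcSide e).indicator 1) := by
  rw [edgeVec, tgtSide_eq_compl hT]
  simp only [← Set.mem_preimage (f := c), Set.preimage_compl, Set.mem_compl_iff]
  exact sum_vec_eq_chi γ (c ⁻¹' T.srcSide e)

lemma sum_smul_edgeVec [Fintype E] (hT : T.IsTree) (a : E → ℝ) :
    ∑ e, a e • T.edgeVec γ c e = chi γ (T.potential a ∘ c) := by
  simp only [edgeVec_eq_chi γ c hT, ← map_smul, ← map_sum]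
  congr 1
  ext i
  simp [potential, Set.indicator_apply]

lemma formB_edgeVec_ray (e : E) : formB γ (T.edgeVec γ c e) (ray γ) = T.edgeDirac γ c e := by
  simp only [edgeVec, edgeDirac, map_sum, LinearMap.sum_apply, formB_vec_ray]

lemma formB_endVec_ray (e : E) : formB γ (T.endVec γ c e) (ray γ) = T.endDirac γ c e := by
  simp only [endVec, endDirac, map_sum, LinearMap.sum_apply, formB_vec_ray]

variable {c}

lemma posIndep_edgeVec [Finite E] (hT : T.IsTree) (hc : Function.Surjective c) :
    PosIndep (formB γ) (T.edgeVec γ c) := by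
  have := Fintype.ofFinite E
  refine .of_forall_sum fun a ha => ?_
  obtain ⟨e, he⟩ := Function.ne_iff.1 ha
  obtain ⟨i, hi⟩ := hc (T.src e)
  obtain ⟨j, hj⟩ := hc (T.tgt e)
  rw [sum_smul_edgeVec γ c hT]
  refine formB_chi_pos γ (i₀ := i) (j₀ := j) fun hij => he ?_
  rw [Function.comp_apply, Function.comp_apply, hi, hj] at hij
  rw [← potential_src_sub_tgt hT a e, hij, sub_self, Pi.zero_apply]

variable (c)

lemma chi_comp_mem_span_edgeVec [Finite E] (hT : T.IsTree) (φ : V → ℝ) :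
    chi γ (φ ∘ c) ∈ Submodule.span ℝ (Set.range (T.edgeVec γ c)) := by
  have := Fintype.ofFinite E
  obtain ⟨r, hr⟩ := eq_potential_add_const hT φ
  rw [show φ ∘ c = T.potential _ ∘ c + fun _ => r from funext fun i => hr (c i), map_add,
    chi_const, add_zero, ← sum_smul_edgeVec γ c hT]
  exact Submodule.sum_mem _ fun e _ => Submodule.smul_mem _ _ (Submodule.subset_span ⟨e, rfl⟩)

lemma edgeVec_contract (J : Finset E) (e : J) :
    (T.contract J).edgeVec γ (fun i => Quotient.mk (T.contractSetoid J) (c i)) e =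
      T.edgeVec γ c e := by
  have mem_srcSide (v : V) : Quotient.mk (T.contractSetoid J) v ∈ (T.contract J).srcSide e ↔
      v ∈ T.srcSide e.1 := contract_linked_iff J e _ v
  have mem_tgtSide (v : V) : Quotient.mk (T.contractSetoid J) v ∈ (T.contract J).tgtSide e ↔
      v ∈ T.tgtSide e.1 := contract_linked_iff J e _ v
  simp only [edgeVec, mem_srcSide, mem_tgtSide]

lemma eContract_eq (J : Finset E) :
    T.eContract γ c J = boostedErr (fun x y => formB γ x y) (fun e : J => T.edgeVec γ c e) 0 := by
  rw [eContract, treeErr, biform_eq]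
  exact congrArg (boostedErr _ · 0) (funext fun e => edgeVec_contract γ c J e)

lemma hasLeading_treeErr [Fintype E] (hT : T.IsTree) (hc : Function.Surjective c) :
    HasLeading (ray γ) 0 (T.treeErr γ c) (T.signSum γ c) := by
  unfold treeErr signSum
  simp only [eContract_eq, ← formB_edgeVec_ray, biform_eq]
  exact hasLeading_boostedErr (formB_isSymm γ) (posIndep_edgeVec γ hT hc) (ray γ)

end Vectors

end OGraph

/-! ### The limit of the vertex functions -/

namespace TreeOn

variable {V : Type} (o : EdgeOrientation V) (G : TreeOn V)

lemma adj_src_tgt (e : G.1.edgeSet) :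
    G.1.Adj ((G.toOGraph o).src e) ((G.toOGraph o).tgt e) := by
  rw [← SimpleGraph.mem_edgeSet]
  exact (o.spec e.1).symm ▸ e.2

lemma linked_of_adj {A : Set G.1.edgeSet} {u v : V} (h : G.1.Adj u v) (hA : ⟨s(u, v), h⟩ ∈ A) :
    (G.toOGraph o).Linked A u v := by
  have linked : (G.toOGraph o).Linked A (o.src s(u, v)) (o.tgt s(u, v)) := .edge hA
  rcases Sym2.eq_iff.1 (o.spec s(u, v)) with ⟨hu, hv⟩ | ⟨hv, hu⟩
  · rwa [hu, hv] at linked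
  · rw [hu, hv] at linked
    exact linked.symm

lemma isTree_toOGraph : (G.toOGraph o).IsTree := by
  refine ⟨G.2.1.nonempty, fun u v => ?_, fun e h => ?_⟩
  · obtain ⟨w⟩ := G.2.1.preconnected u v
    induction w with
    | nil => exact .refl _ _
    | cons h _ ih => exact (G.linked_of_adj o h (Set.mem_univ _)).trans ih
  · have bridge := SimpleGraph.isAcyclic_iff_forall_isBridge.1 G.2.2 e.2
    rw [← o.spec e.1, SimpleGraph.isBridge_iff] at bridge
    refine bridge (OGraph.Linked.of_equivalence (SimpleGraph.reachable_is_equivalence _)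
      (fun e' he' => SimpleGraph.Adj.reachable ?_) h)
    refine SimpleGraph.deleteEdges_adj.2 ⟨G.adj_src_tgt o e', fun h => he' (Subtype.ext ?_)⟩
    rw [Set.mem_singleton_iff, o.spec e.1] at h
    exact (o.spec e'.1).symm.trans h

lemma card_edgeSet [Fintype V] : Fintype.card G.1.edgeSet = Fintype.card V - 1 := by
  rw [← G.2.card_edgeFinset, SimpleGraph.edgeFinset_card, Nat.add_sub_cancel]

end TreeOn

section Limit

variable {b n : ℕ} {X : IntersectionData b} (o : ∀ V : Type, EdgeOrientation V)
  (γ : Fin n → Charge X)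

namespace HasLeading

variable {N : ℕ} {f : (Fin n → Fin b → ℝ) → ℝ} {A : ℝ}

lemma diffOp {ξ : Fin n → Fin b → ℝ} (hf : HasLeading ξ N f A) (v : Fin n → Fin b → ℝ) :
    HasLeading ξ (N + 1) (diffOp γ v f) (formB γ v ξ * A) := by
  unfold D4Completion.diffOp
  rw [biform_eq]
  exact hf.linear_mul_add_fderiv (LinearMap.toContinuousLinearMap (formB γ v)) _ v

lemma markOp {B : Finset (Fin n)} (hf : HasLeading (ray γ) N f A) :
    HasLeading (ray γ) (N + (B.card - 1)) (markOp o γ B f) (markFactor o γ B * A) := by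
  unfold D4Completion.markOp markFactor
  rw [Finset.sum_mul]
  refine .sum _ fun G _ => ?_
  rw [mul_assoc]
  refine .const_mul ?_ _
  have card_eq : B.card - 1 = ∑ _e : G.1.edgeSet, 1 := by
    rw [Finset.sum_const, smul_eq_mul, mul_one, Finset.card_univ, G.card_edgeSet, Fintype.card_coe]
  rw [card_eq]
  refine .opProd (fun e N f A hf => ?_) hf
  rw [← formB_vec_ray]
  exact hf.diffOp γ _

end HasLeading

lemma blockOf_surjective (P : Finpartition (Finset.univ : Finset (Fin n))) :
    Function.Surjective (blockOf P) := by
  rintro ⟨B, hB⟩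
  obtain ⟨i, hi⟩ := P.nonempty_of_mem_parts hB
  exact ⟨i, Subtype.ext (P.part_eq_of_mem hB hi)⟩

lemma card_edgeSet_add_sum_card_sub_one {P : Finpartition (Finset.univ : Finset (Fin n))}
    (G : TreeOn (Blocks P)) :
    Fintype.card G.1.edgeSet + ∑ B : Blocks P, (B.1.card - 1) = n - 1 := by
  have card_blocks : ∑ B : Blocks P, (B.1.card - 1) + Fintype.card (Blocks P) = n := by
    have sum_card : ∑ B : Blocks P, B.1.card = n := by
      rw [Finset.sum_coe_sort P.parts, P.sum_card_parts, Finset.card_univ, Fintype.card_fin]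
    rw [Fintype.card_eq_sum_ones, ← Finset.sum_add_distrib]
    refine Eq.trans ?_ sum_card
    exact Finset.sum_congr rfl fun B _ =>
      Nat.sub_add_cancel (P.nonempty_of_mem_parts B.2).card_pos
  have := G.2.1.nonempty
  have card_pos : 0 < Fintype.card (Blocks P) := Fintype.card_pos
  have card_edges := G.card_edgeSet
  omega

lemma hasLeading_vertexKernel :
    HasLeading (ray γ) (n - 1) (vertexKernel o γ) (vertexLimit o γ) := by
  unfold vertexKernel vertexLimit
  refine .const_mul (.sum _ fun m _ => .sum _ fun P _ => .sum _ fun G _ => ?_) _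
  have order_eq : n - 1 = 0 + ∑ _e : G.1.edgeSet, 1 + ∑ B : Blocks P, (B.1.card - 1) := by
    rw [← card_edgeSet_add_sum_card_sub_one G, zero_add, Finset.sum_const, smul_eq_mul, mul_one,
      Finset.card_univ]
  rw [mul_assoc, order_eq]
  refine .opProd (fun B N f A hf => hf.markOp o γ) ?_
  refine .opProd (fun e N f A hf => ?_)
    (OGraph.hasLeading_treeErr γ _ (G.isTree_toOGraph _) (blockOf_surjective P))
  rw [← OGraph.formB_endVec_ray]
  exact hf.diffOp γ _

theorem tendsto_vertexFn : Tendsto (vertexFn o γ) atTop (𝓝 (vertexLimit o γ)) := by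
  have scale : Tendsto (fun τ : ℝ => Real.sqrt (2 * τ)) atTop atTop :=
    Real.tendsto_sqrt_atTop.comp (tendsto_id.const_mul_atTop two_pos)
  exact (hasLeading_vertexKernel o γ).2.comp scale

end Limit

/-! ### Gluing trees -/

namespace OGraph

lemma isTree_of_cuts {V E : Type} {T : OGraph V E} (v₀ : V) (hv₀ : ∀ v, T.Linked Set.univ v₀ v)
    (hcut : ∀ e, ∃ S, T.Cuts e S) : T.IsTree :=
  ⟨⟨v₀⟩, fun v w => (hv₀ v).symm.trans (hv₀ w), fun e =>
    let ⟨_, hS⟩ := hcut e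
    not_linked_of_cuts hS⟩

section Join

variable {I F : Type} {V E : I → Type} (S : OGraph I F) (T : ∀ i, OGraph (V i) (E i))
  (u : ∀ i, V i)

/-- The graph obtained from `S` by replacing each vertex `i` by the graph `T i`, to which the edges
of `S` are attached at the vertex `u i`. -/
def join : OGraph (Σ i, V i) ((Σ i, E i) ⊕ F) where
  src := Sum.elim (fun e => ⟨e.1, (T e.1).src e.2⟩) fun s => ⟨S.src s, u (S.src s)⟩
  tgt := Sum.elim (fun e => ⟨e.1, (T e.1).tgt e.2⟩) fun s => ⟨S.tgt s, u (S.tgt s)⟩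

/-- The map from the vertices of a join to those of the constituent `T i` which collapses all the
other constituents to the vertex `u i`. -/
def retract (i : I) (x : Σ i, V i) : V i := if h : x.1 = i then h ▸ x.2 else u i

@[simp]
lemma retract_mk (i : I) (v : V i) : retract u i ⟨i, v⟩ = v := by simp [retract]

lemma retract_of_ne {i j : I} (h : j ≠ i) (v : V j) : retract u i ⟨j, v⟩ = u i := by
  simp [retract, h]

@[simp]
lemma retract_base (i j : I) : retract u i ⟨j, u j⟩ = u i := by
  rcases eq_or_ne j i with rfl | h
  · simp
  · exact retract_of_ne u h _

variable {S T}

lemma join_cuts_inl {e : Σ i, E i} {A : Set (V e.1)} (hA : (T e.1).Cuts e.2 A) :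
    (S.join T u).Cuts (Sum.inl e) (retract u e.1 ⁻¹' A) := by
  obtain ⟨i, e⟩ := e
  refine ⟨by simpa [join] using hA.1, by simpa [join] using hA.2.1, ?_⟩
  rintro (⟨j, e'⟩ | s) he
  · rcases eq_or_ne j i with rfl | hj
    · simpa [join] using hA.2.2 e' fun h => he (by rw [h])
    · simp [join, retract_of_ne u hj]
  · simp [join]

lemma join_cuts_inr {s : F} {A : Set I} (hA : S.Cuts s A) :
    (S.join T u).Cuts (Sum.inr s) (Sigma.fst ⁻¹' A) := by
  refine ⟨hA.1, hA.2.1, ?_⟩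
  rintro (e | s') hs
  · exact Iff.rfl
  · exact hA.2.2 s' fun h => hs (congrArg Sum.inr h)

lemma join_isTree (hS : S.IsTree) (hT : ∀ i, (T i).IsTree) : (S.join T u).IsTree := by
  obtain ⟨i₀⟩ := hS.1
  have linked_base (i : I) : (S.join T u).Linked Set.univ ⟨i₀, u i₀⟩ ⟨i, u i⟩ :=
    Linked.of_edges (fun i => (⟨i, u i⟩ : Σ i, V i))
      (fun s _ => .edge (T := S.join T u) (e := .inr s) (Set.mem_univ _)) (hS.2.1 i₀ i)
  have linked_fiber (i : I) (v : V i) : (S.join T u).Linked Set.univ ⟨i, u i⟩ ⟨i, v⟩ :=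
    Linked.of_edges (T := T i) (Sigma.mk i)
      (fun e _ => .edge (T := S.join T u) (e := .inl ⟨i, e⟩) (Set.mem_univ _)) ((hT i).2.1 (u i) v)
  refine isTree_of_cuts ⟨i₀, u i₀⟩ (fun x => (linked_base x.1).trans (linked_fiber x.1 x.2)) ?_
  rintro (e | s)
  · exact ⟨_, join_cuts_inl u (cuts_srcSide (hT e.1) e.2)⟩
  · exact ⟨_, join_cuts_inr u (cuts_srcSide hS s)⟩

variable {b n : ℕ} {X : IntersectionData b} (γ : Fin n → Charge X) (c : Fin n → Σ i, V i)

lemma edgeVec_join_inl (hS : S.IsTree) (hT : ∀ i, (T i).IsTree) (e : Σ i, E i) :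
    (S.join T u).edgeVec γ c (Sum.inl e) =
      chi γ ((c ⁻¹' (retract u e.1 ⁻¹' (T e.1).srcSide e.2)).indicator 1) := by
  rw [edgeVec_eq_chi γ c (join_isTree u hS hT), srcSide_eq_of_cuts (join_isTree u hS hT)
    (join_cuts_inl u (cuts_srcSide (hT e.1) e.2))]

lemma edgeVec_join_inr (hS : S.IsTree) (hT : ∀ i, (T i).IsTree) {s : F} {A : Set I}
    (hA : S.Cuts s A) :
    (S.join T u).edgeVec γ c (Sum.inr s) = chi γ ((Sigma.fst ∘ c ⁻¹' A).indicator 1) := by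
  rw [edgeVec_eq_chi γ c (join_isTree u hS hT), srcSide_eq_of_cuts (join_isTree u hS hT)
    (join_cuts_inr u hA), Set.preimage_comp]

end Join

section Origin

variable {V E K : Type} {T : OGraph V E} {b n : ℕ} {X : IntersectionData b}
  (γ : Fin n → Charge X) {c : Fin n → V}

lemma exists_orthonormalFor [Finite E] (hT : T.IsTree) (hc : Function.Surjective c) :
    ∃ g : E → Fin n → Fin b → ℝ, OrthonormalFor (formB γ) g ∧
      ∀ φ : V → ℝ, chi γ (φ ∘ c) ∈ Submodule.span ℝ (Set.range g) := by
  obtain ⟨g, hg, hspan⟩ := (posIndep_edgeVec γ hT hc).exists_frame (formB_isSymm γ)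
  exact ⟨g, hg, fun φ => hspan ▸ chi_comp_mem_span_edgeVec γ c hT φ⟩

variable {γ} {g : K → Fin n → Fin b → ℝ}

lemma edgeVec_mem_span (hT : T.IsTree)
    (hspan : ∀ φ : V → ℝ, chi γ (φ ∘ c) ∈ Submodule.span ℝ (Set.range g)) (e : E) :
    T.edgeVec γ c e ∈ Submodule.span ℝ (Set.range g) :=
  edgeVec_eq_chi γ c hT e ▸ hspan ((T.srcSide e).indicator 1)

variable [Fintype K]

lemma treeErr_zero_eq_integral [Fintype E] (hT : T.IsTree) (hc : Function.Surjective c)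
    (hg : OrthonormalFor (formB γ) g)
    (hspan : ∀ φ : V → ℝ, chi γ (φ ∘ c) ∈ Submodule.span ℝ (Set.range g)) :
    T.treeErr γ c 0 =
      ∫ a, ∏ e, Real.sign (formB γ (T.edgeVec γ c e) (∑ k, a k • g k)) ∂gaussMeasure K := by
  rw [treeErr, biform_eq, boostedErr_zero_eq_integral (formB_isSymm γ) (posIndep_edgeVec γ hT hc)
    hg (edgeVec_mem_span hT hspan)]

lemma eContract_eq_integral [Finite E] (hT : T.IsTree) (hc : Function.Surjective c)
    (hg : OrthonormalFor (formB γ) g)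
    (hspan : ∀ φ : V → ℝ, chi γ (φ ∘ c) ∈ Submodule.span ℝ (Set.range g)) (J : Finset E) :
    T.eContract γ c J =
      ∫ a, ∏ e ∈ J, Real.sign (formB γ (T.edgeVec γ c e) (∑ k, a k • g k)) ∂gaussMeasure K := by
  rw [eContract_eq, boostedErr_zero_eq_integral (formB_isSymm γ)
    ((posIndep_edgeVec γ hT hc).comp Subtype.val_injective) hg
    fun e : J => edgeVec_mem_span hT hspan e.1]
  exact integral_congr_ae (.of_forall fun a => Finset.prod_coe_sort J fun e =>
    Real.sign (formB γ (T.edgeVec γ c e) (∑ k, a k • g k)))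

end Origin

end OGraph

/-! ### The identity for three trees -/

section Identity

lemma sign_mul_cyclic {x : Fin 3 → ℝ} (hsum : ∑ s, x s = 0) (hx : x 0 ≠ 0) :
    Real.sign (x 2) * Real.sign (x 1) + Real.sign (x 1) * Real.sign (x 0) +
      Real.sign (x 2) * Real.sign (x 0) = -1 := by
  rw [Fin.sum_univ_three] at hsum
  rcases lt_trichotomy (x 0) 0 with h0 | h0 | h0 <;>
    rcases lt_trichotomy (x 1) 0 with h1 | h1 | h1 <;>
      rcases lt_trichotomy (x 2) 0 with h2 | h2 | h2 <;>
        first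
        | (exfalso; first | exact hx h0 | linarith)
        | norm_num [h0, h1, h2, Real.sign_of_neg, Real.sign_of_pos]

section Gaussian

variable {E K W : Type} [Fintype E] [Fintype K] [AddCommGroup W] [Module ℝ W]
  {β : LinearMap.BilinForm ℝ W} {g : K → W} {w : Fin 3 → W}

lemma ae_sign_mul_cyclic (hg : OrthonormalFor β g) (hw : w 0 ∈ Submodule.span ℝ (Set.range g))
    (hw0 : w 0 ≠ 0) (hsum : ∑ s, w s = 0) : ∀ᵐ a ∂gaussMeasure K,
      let σ := fun s => Real.sign (β (w s) (∑ k, a k • g k))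
      σ 2 * σ 1 + σ 1 * σ 0 + σ 2 * σ 0 = -1 := by
  filter_upwards [hg.ae_apply_ne_zero hw hw0] with a ha
  refine sign_mul_cyclic (x := fun s => β (w s) (∑ k, a k • g k)) ?_ ha
  rw [← LinearMap.sum_apply, ← map_sum, hsum, map_zero, LinearMap.zero_apply]

lemma integral_prod_sign_mul_cyclic (hg : OrthonormalFor β g)
    (hw : w 0 ∈ Submodule.span ℝ (Set.range g)) (hw0 : w 0 ≠ 0) (hsum : ∑ s, w s = 0)
    (z : E → W) :
    let F := fun a : K → ℝ => ∏ e, Real.sign (β (z e) (∑ k, a k • g k))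
    let σ := fun s (a : K → ℝ) => Real.sign (β (w s) (∑ k, a k • g k))
    ∫ a, F a * (σ 2 a * σ 1 a) ∂gaussMeasure K + ∫ a, F a * (σ 1 a * σ 0 a) ∂gaussMeasure K +
      ∫ a, F a * (σ 2 a * σ 0 a) ∂gaussMeasure K = -∫ a, F a ∂gaussMeasure K := by
  intro F σ
  have integrable (s t : Fin 3) : Integrable (fun a => F a * (σ s a * σ t a)) (gaussMeasure K) := by
    simpa only [Fintype.prod_sum_type, Fin.prod_univ_two, Sum.elim_inl, Sum.elim_inr,
      Matrix.cons_val] using integrable_prod_sign_linear β (Sum.elim z ![w s, w t]) g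
  rw [← integral_add (integrable 2 1) (integrable 1 0),
    ← integral_add ((integrable 2 1).fun_add (integrable 1 0)) (integrable 2 0), ← integral_neg]
  refine integral_congr_ae ((ae_sign_mul_cyclic hg hw hw0 hsum).mono fun a ha => ?_)
  change F a * (σ 2 a * σ 1 a) + F a * (σ 1 a * σ 0 a) + F a * (σ 2 a * σ 0 a) = -F a
  rw [← mul_add, ← mul_add]
  exact (congrArg (F a * ·) ha).trans (mul_neg_one _)

end Gaussian

variable {b n : ℕ} {X : IntersectionData b} (γ : Fin n → Charge X)

lemma chi_indicator_compl (S : Set (Fin n)) :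
    chi γ (Sᶜ.indicator 1) = -chi γ (S.indicator 1) := by
  rw [eq_neg_iff_add_eq_zero, ← map_add, Set.indicator_compl_add_self]
  exact chi_const γ 1

lemma chi_indicator_ne_zero {S : Set (Fin n)} {i j : Fin n} (hi : i ∈ S) (hj : j ∉ S) :
    chi γ (S.indicator 1) ≠ 0 := by
  intro h
  have pos := formB_chi_pos γ (φ := S.indicator 1) (i₀ := i) (j₀ := j) (by simp [hi, hj])
  simp [h] at pos

lemma sum_chi_indicator_fiber {I : Type} [Fintype I] (q : Fin n → I) :
    ∑ s, chi γ ((q ⁻¹' {s}).indicator 1) = 0 := by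
  rw [← map_sum, ← chi_const γ 1]
  congr 1
  ext i
  simp [Set.indicator_apply]

variable {K : Type} [Fintype K] {g : K → Fin n → Fin b → ℝ} {γ}

/-- The paths with two of the edges `e₁ : 0 → 1`, `e₂ : 0 → 2`, `e₃ : 1 → 2`, in the order in which
they occur in `hatTree`. -/
def hatSkeleton : Fin 3 → OGraph (Fin 3) Bool :=
  ![⟨fun _ => 0, fun s => bif s then 2 else 1⟩, ⟨fun s => bif s then 1 else 0, fun _ => 2⟩,
    ⟨fun s => bif s then 1 else 0, fun s => bif s then 2 else 1⟩]

/-- The part containing the source after the removal of one of the edges of `hatSkeleton`. -/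
def hatSide : Fin 3 → Bool → Set (Fin 3) :=
  ![fun s => bif s then {2}ᶜ else {1}ᶜ, fun s => bif s then {1} else {0},
    fun s => bif s then {2}ᶜ else {0}]

lemma hatSkeleton_cuts (r : Fin 3) (s : Bool) : (hatSkeleton r).Cuts s (hatSide r s) := by
  fin_cases r <;> cases s <;> simp [hatSkeleton, hatSide, OGraph.Cuts]

lemma hatSkeleton_isTree (r : Fin 3) : (hatSkeleton r).IsTree := by
  have edge (s : Bool) : (hatSkeleton r).Linked Set.univ _ _ := .edge (e := s) (Set.mem_univ _)
  refine OGraph.isTree_of_cuts 0 (fun v => ?_) fun s => ⟨_, hatSkeleton_cuts r s⟩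
  fin_cases r <;> fin_cases v
  exacts [.refl _ _, edge false, edge true, .refl _ _, (edge false).trans (edge true).symm,
    edge false, .refl _ _, edge false, (edge false).trans (edge true)]

variable {V E : Fin 3 → Type} {T : ∀ r, OGraph (V r) (E r)} {u : ∀ r, V r}
  {c : Fin n → Σ r, V r}

lemma hatTree_eq_join (r : Fin 3) : hatTree T u r = (hatSkeleton r).join T u := by
  fin_cases r <;>
    exact congrArg₂ OGraph.mk (funext fun e => by rcases e with _ | _ | _ <;> rfl)
      (funext fun e => by rcases e with _ | _ | _ <;> rfl)

variable [∀ r, Fintype (E r)]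

lemma treeErr_hatTree_eq_integral (hT : ∀ r, (T r).IsTree) (hc : Function.Surjective c)
    (hg : OrthonormalFor (formB γ) g)
    (hspan : ∀ φ : (Σ r, V r) → ℝ, chi γ (φ ∘ c) ∈ Submodule.span ℝ (Set.range g)) (r : Fin 3) :
    (hatTree T u r).treeErr γ c 0 = ∫ a,
      (∏ e : Σ r, E r, Real.sign (formB γ
        (chi γ ((c ⁻¹' (OGraph.retract u e.1 ⁻¹' (T e.1).srcSide e.2)).indicator 1))
        (∑ k, a k • g k))) *
      ∏ s, Real.sign (formB γ (chi γ ((Sigma.fst ∘ c ⁻¹' hatSide r s).indicator 1))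
        (∑ k, a k • g k)) ∂gaussMeasure K := by
  have isTree := OGraph.join_isTree u (hatSkeleton_isTree r) hT
  rw [hatTree_eq_join, OGraph.treeErr_zero_eq_integral isTree hc hg hspan]
  simp only [Fintype.prod_sum_type, OGraph.edgeVec_join_inl u γ c (hatSkeleton_isTree r) hT,
    OGraph.edgeVec_join_inr u γ c (hatSkeleton_isTree r) hT (hatSkeleton_cuts r _)]

lemma eContract_hatTree_eq_integral (hT : ∀ r, (T r).IsTree) (hc : Function.Surjective c)
    (hg : OrthonormalFor (formB γ) g)
    (hspan : ∀ φ : (Σ r, V r) → ℝ, chi γ (φ ∘ c) ∈ Submodule.span ℝ (Set.range g)) (r : Fin 3) :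
    (hatTree T u r).eContract γ c oldEdges = ∫ a, ∏ e : Σ r, E r, Real.sign (formB γ
      (chi γ ((c ⁻¹' (OGraph.retract u e.1 ⁻¹' (T e.1).srcSide e.2)).indicator 1))
      (∑ k, a k • g k)) ∂gaussMeasure K := by
  have isTree := OGraph.join_isTree u (hatSkeleton_isTree r) hT
  rw [hatTree_eq_join, OGraph.eContract_eq_integral isTree hc hg hspan]
  simp only [oldEdges, Finset.prod_filter, Fintype.prod_sum_type, Sum.isLeft_inl, Sum.isLeft_inr,
    if_true, Bool.false_eq_true, if_false, Finset.prod_const_one, mul_one,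
    OGraph.edgeVec_join_inl u γ c (hatSkeleton_isTree r) hT]

theorem treeErr_hatTree (hT : ∀ r, (T r).IsTree) (hc : Function.Surjective c) (r : Fin 3) :
    (hatTree T u 0).treeErr γ c 0 + (hatTree T u 1).treeErr γ c 0 - (hatTree T u 2).treeErr γ c 0 =
      -((hatTree T u r).eContract γ c oldEdges) := by
  obtain ⟨g, hg, hspan⟩ := OGraph.exists_orthonormalFor γ
    (OGraph.join_isTree u (hatSkeleton_isTree 0) hT) hc
  set z : (Σ r, E r) → Fin n → Fin b → ℝ := fun e =>
    chi γ ((c ⁻¹' (OGraph.retract u e.1 ⁻¹' (T e.1).srcSide e.2)).indicator 1)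
  set w : Fin 3 → Fin n → Fin b → ℝ := fun s => chi γ ((Sigma.fst ∘ c ⁻¹' {s}).indicator 1)
  have sign_compl (s : Fin 3) (y : Fin n → Fin b → ℝ) :
      Real.sign (formB γ (chi γ ((Sigma.fst ∘ c ⁻¹' {s}ᶜ).indicator 1)) y) =
        -Real.sign (formB γ (w s) y) := by
    rw [Set.preimage_compl, chi_indicator_compl, map_neg, LinearMap.neg_apply, Real.sign_neg]
  have w_zero_ne_zero : w 0 ≠ 0 := by
    obtain ⟨i, hi⟩ := hc ⟨0, u 0⟩
    obtain ⟨j, hj⟩ := hc ⟨1, u 1⟩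
    exact chi_indicator_ne_zero γ (i := i) (j := j) (by simp [hi]) (by simp [hj])
  have cyclic := integral_prod_sign_mul_cyclic hg (hspan ((Sigma.fst ⁻¹' {0}).indicator 1))
    w_zero_ne_zero (sum_chi_indicator_fiber γ (Sigma.fst ∘ c)) z
  rw [eContract_hatTree_eq_integral hT hc hg hspan, ← cyclic]
  simp only [treeErr_hatTree_eq_integral hT hc hg hspan, Fintype.prod_bool, hatSide,
    Matrix.cons_val, cond_true, cond_false, sign_compl, neg_mul, mul_neg, neg_neg,
    integral_neg, sub_neg_eq_add]
  rfl

end Identity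

/-! ### Star trees -/

lemma preimage_singleton_apply {α β : Type*} {f : α → β} (hf : Function.Injective f) (a : α) :
    f ⁻¹' {f a} = {a} := by
  rw [← Set.image_singleton, Set.preimage_image_eq _ hf]

lemma dirac_swap {b n : ℕ} {X : IntersectionData b} (γ : Fin n → Charge X) (i j : Fin n) :
    dirac γ j i = -dirac γ i j := by
  simp only [dirac, ← Finset.sum_neg_distrib, neg_sub]

namespace OGraph

variable {V E : Type} {T : OGraph V E}

lemma cuts_singleton_src (hT : T.IsTree) {e : E}
    (leaf : ∀ e', T.src e' = T.src e ∨ T.tgt e' = T.src e → e' = e) : T.Cuts e {T.src e} := by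
  refine ⟨rfl, fun h : T.tgt e = T.src e => hT.2.2 e (h ▸ .refl _ _), fun e' he' => ?_⟩
  exact iff_of_false (fun h => he' (leaf e' (.inl h))) fun h => he' (leaf e' (.inr h))

lemma cuts_compl_singleton_tgt (hT : T.IsTree) {e : E}
    (leaf : ∀ e', T.src e' = T.tgt e ∨ T.tgt e' = T.tgt e → e' = e) :
    T.Cuts e {T.tgt e}ᶜ := by
  refine ⟨fun h : T.src e = T.tgt e => hT.2.2 e (h ▸ .refl _ _), not_not_intro rfl,
    fun e' he' => ?_⟩
  exact iff_of_true (fun h => he' (leaf e' (.inl h))) fun h => he' (leaf e' (.inr h))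

variable {b n : ℕ} {X : IntersectionData b} (γ : Fin n → Charge X) {c : Fin n → V}

lemma endDirac_of_injective (hc : Function.Injective c) {e : E} {i j : Fin n}
    (hs : T.src e = c i) (ht : T.tgt e = c j) : T.endDirac γ c e = dirac γ i j := by
  simp [endDirac, hs, ht, hc.eq_iff, Finset.filter_eq']

/-- The factors `γ_{s(e)t(e)}` and `sgn(v_e · y)` both change sign with the orientation of `e`. -/
lemma endDirac_mul_sign_edgeVec_of_leaf (hT : T.IsTree) (hc : Function.Injective c) {e : E}
    {i j : Fin n} (ends : s(T.src e, T.tgt e) = s(c i, c j))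
    (leaf : ∀ e', T.src e' = c i ∨ T.tgt e' = c i → e' = e) (y : Fin n → Fin b → ℝ) :
    T.endDirac γ c e * Real.sign (formB γ (T.edgeVec γ c e) y) =
      dirac γ i j * Real.sign (formB γ (chi γ (({i} : Set (Fin n)).indicator 1)) y) := by
  have fiber : c ⁻¹' {c i} = {i} := preimage_singleton_apply hc i
  rw [edgeVec_eq_chi γ c hT]
  rcases Sym2.eq_iff.1 ends with ⟨hs, ht⟩ | ⟨hs, ht⟩
  · rw [endDirac_of_injective γ hc hs ht, srcSide_eq_of_cuts hT
      (cuts_singleton_src hT fun e' he' => leaf e' (hs ▸ he')), hs, fiber]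
  · rw [endDirac_of_injective γ hc hs ht, srcSide_eq_of_cuts hT
      (cuts_compl_singleton_tgt hT fun e' he' => leaf e' (ht ▸ he')), ht, Set.preimage_compl, fiber,
      chi_indicator_compl, dirac_swap, map_neg, LinearMap.neg_apply, Real.sign_neg, neg_mul_neg]

end OGraph

section Stars

variable {V : Type}

/-- The tree in which all other vertices are joined to `v`. -/
def starTree (v : V) : TreeOn V := ⟨SimpleGraph.starGraph v, SimpleGraph.isTree_starGraph v⟩

lemma TreeOn.eq_starTree_of_isUniversal (G : TreeOn V) {v : V} (hv : G.1.IsUniversal v) :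
    G = starTree v := by
  have star_le : SimpleGraph.starGraph v ≤ G.1 := fun u w huw => by
    rw [SimpleGraph.starGraph_adj] at huw
    rcases huw with ⟨hne, rfl | rfl⟩
    · exact hv hne
    · exact (hv hne.symm).symm
  exact Subtype.ext (((SimpleGraph.isTree_iff_minimal_connected.1 G.2).2
    (SimpleGraph.connected_starGraph v) star_le).antisymm star_le)

lemma TreeOn.exists_isUniversal_of_card_eq_three [Fintype V] (hV : Fintype.card V = 3)
    (G : TreeOn V) : ∃ v, G.1.IsUniversal v := by
  have sum_degrees : ∑ v, G.1.degree v = 4 := by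
    have := G.2.card_edgeFinset
    rw [G.1.sum_degrees_eq_twice_card_edges]
    omega
  obtain ⟨v, -, hv⟩ : ∃ v ∈ Finset.univ, 1 < G.1.degree v :=
    Finset.exists_lt_of_sum_lt (by simp [sum_degrees, hV])
  have := G.1.degree_lt_card_verts v
  exact ⟨v, (G.1.degree_eq_card_sub_one v).1 (by omega)⟩

lemma starTree_injective [Fintype V] (hV : 2 < Fintype.card V) :
    Function.Injective (starTree : V → TreeOn V) := by
  intro v w h
  by_contra hne
  obtain ⟨u, hu⟩ : ∃ u, u ∉ ({v, w} : Finset V) := by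
    by_contra! hall
    have := Finset.card_le_card fun u (_ : u ∈ Finset.univ) => hall u
    rw [Finset.card_univ, Finset.card_pair hne] at this
    omega
  simp only [Finset.mem_insert, Finset.mem_singleton, not_or] at hu
  have adj : (SimpleGraph.starGraph w).Adj v u :=
    congrArg (fun G => G.1.Adj v u) h ▸ SimpleGraph.starGraph_center_adj (Ne.symm hu.1)
  exact (SimpleGraph.starGraph_adj.1 adj).2.elim hne hu.2

lemma starTree_bijective_of_card_eq_three [Fintype V] (hV : Fintype.card V = 3) :
    Function.Bijective (starTree : V → TreeOn V) :=
  ⟨starTree_injective (by omega), fun G =>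
    let ⟨v, hv⟩ := G.exists_isUniversal_of_card_eq_three hV
    ⟨v, (G.eq_starTree_of_isUniversal hv).symm⟩⟩

/-- The edge joining `v` to the center of a star. -/
def starEdge {r v : V} (hv : v ≠ r) : (starTree r).1.edgeSet :=
  ⟨s(v, r), SimpleGraph.starGraph_center_adj' hv.symm⟩

lemma eq_starEdge_of_mem {r v : V} (hv : v ≠ r) {e : (starTree r).1.edgeSet} (he : v ∈ e.1) :
    e = starEdge hv := by
  obtain ⟨u, hu⟩ := he
  have adj : (SimpleGraph.starGraph r).Adj v u := by
    rw [← SimpleGraph.mem_edgeSet, ← hu]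
    exact e.2
  exact Subtype.ext (hu.trans (by rw [(SimpleGraph.starGraph_adj.1 adj).2.resolve_left hv]; rfl))

lemma starEdge_bijective (r : V) :
    Function.Bijective fun v : {v // v ≠ r} => starEdge v.2 := by
  refine ⟨fun v w h => Subtype.ext ?_, fun ⟨e, he⟩ => ?_⟩
  · exact Sym2.congr_left.1 (congrArg Subtype.val h)
  · induction e with
    | h u w =>
      rcases SimpleGraph.starGraph_adj.1 he with ⟨hne, rfl | rfl⟩
      · exact ⟨⟨w, hne.symm⟩, Subtype.ext Sym2.eq_swap⟩
      · exact ⟨⟨u, hne⟩, rfl⟩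

variable (o : EdgeOrientation V) {b n : ℕ} {X : IntersectionData b} (γ : Fin n → Charge X)
  {c : Fin n → V}

lemma prod_endDirac_mul_sign_starTree (hc : Function.Bijective c) (j : Fin n)
    [Fintype (starTree (c j)).1.edgeSet] (y : Fin n → Fin b → ℝ) :
    let T := (starTree (c j)).toOGraph o
    ∏ e, T.endDirac γ c e * Real.sign (formB γ (T.edgeVec γ c e) y) =
      ∏ i with i ≠ j,
        dirac γ i j * Real.sign (formB γ (chi γ (({i} : Set (Fin n)).indicator 1)) y) := by
  intro T
  have hT : T.IsTree := (starTree (c j)).isTree_toOGraph o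
  let vertex : {i // i ≠ j} ≃ {v // v ≠ c j} :=
    (Equiv.ofBijective c hc).subtypeEquiv fun i => hc.1.ne_iff.symm
  rw [Finset.prod_subtype (p := (· ≠ j)) _ (by simp),
    ← ((starEdge_bijective (c j)).comp vertex.bijective).prod_comp]
  refine Finset.prod_congr rfl fun i _ => ?_
  have ends : s(T.src (starEdge (vertex i).2), T.tgt (starEdge (vertex i).2)) = s(c i, c j) :=
    o.spec _
  refine T.endDirac_mul_sign_edgeVec_of_leaf γ hT hc.1 ends
    (fun e he => eq_starEdge_of_mem (hc.1.ne i.2) ?_) y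
  rw [← o.spec e.1, Sym2.mem_iff]
  exact he.imp Eq.symm Eq.symm

end Stars

namespace OGraph

variable {V E : Type} [Fintype E] {T : OGraph V E} {b n : ℕ} {X : IntersectionData b}
  {γ : Fin n → Charge X} {c : Fin n → V}

lemma signSum_eq : T.signSum γ c = T.eContract γ c {e | T.edgeDirac γ c e = 0} *
    ∏ e with T.edgeDirac γ c e ≠ 0, Real.sign (T.edgeDirac γ c e) :=
  sum_mul_prod_zero_mul_prod_sign _ _

lemma signSum_eq_signProd (hT : T.IsTree) (hc : Function.Surjective c)
    (h : ∀ e, T.edgeDirac γ c e ≠ 0) : T.signSum γ c = T.signProd γ c := by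
  obtain ⟨g, hg, hspan⟩ := exists_orthonormalFor γ hT hc
  rw [signSum_eq, eContract_eq_integral hT hc hg hspan, signProd]
  simp [h]

lemma kappa_mul_signSum_eq_integral {K : Type} [Fintype K] {g : K → Fin n → Fin b → ℝ}
    (hT : T.IsTree) (hc : Function.Surjective c) (hg : OrthonormalFor (formB γ) g)
    (hspan : ∀ φ : V → ℝ, chi γ (φ ∘ c) ∈ Submodule.span ℝ (Set.range g))
    (h : ∀ e, T.edgeDirac γ c e = 0) :
    T.kappa γ c * T.signSum γ c = ∫ a, ∏ e,
      T.endDirac γ c e * Real.sign (formB γ (T.edgeVec γ c e) (∑ k, a k • g k))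
        ∂gaussMeasure K := by
  rw [signSum_eq, eContract_eq_integral hT hc hg hspan]
  simp [h, kappa, Finset.prod_mul_distrib, integral_const_mul]

end OGraph

/-! ### Three charges with cyclic products -/

section ThreeCharges

lemma formB_chi_ray {b n : ℕ} {X : IntersectionData b} (γ : Fin n → Charge X) (φ : Fin n → ℝ) :
    formB γ (chi γ φ) (ray γ) = ∑ i, φ i * ∑ j, dirac γ i j := by
  have dirac_eq (i j : Fin n) :
      dirac γ i j = realVec (γ j).p ⬝ᵥ (γ i).q - realVec (γ i).p ⬝ᵥ (γ j).q := by
    simp [dirac, dotProduct, realVec, Finset.sum_sub_distrib]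
  simp only [formB_ray, chi_apply, sum_dotProduct, smul_dotProduct, smul_eq_mul, dirac_eq,
    Finset.mul_sum, sub_mul, mul_sub, Finset.sum_sub_distrib]
  rw [Finset.sum_comm (f := fun i j => φ j * _)]

variable {V : Type} {b : ℕ} {X : IntersectionData b}

lemma edgeDirac_eq_zero {n : ℕ} {γ : Fin n → Charge X} (hγ : ∀ i, ∑ j, dirac γ i j = 0)
    {E : Type} {T : OGraph V E} (hT : T.IsTree) (c : Fin n → V) (e : E) :
    T.edgeDirac γ c e = 0 := by
  rw [← OGraph.formB_edgeVec_ray, OGraph.edgeVec_eq_chi γ c hT, formB_chi_ray]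
  simp [hγ]

variable (o : EdgeOrientation V)

lemma signProd_toOGraph_eq_zero [Fintype V] {n : ℕ} {γ : Fin n → Charge X}
    (hγ : ∀ i, ∑ j, dirac γ i j = 0) (hV : 1 < Fintype.card V) (c : Fin n → V) (G : TreeOn V) :
    (G.toOGraph o).signProd γ c = 0 := by
  have := G.card_edgeSet
  obtain ⟨e⟩ : Nonempty G.1.edgeSet := Fintype.card_pos_iff.1 (by omega)
  refine Finset.prod_eq_zero (Finset.mem_univ e) ?_
  rw [edgeDirac_eq_zero hγ (G.isTree_toOGraph o), Real.sign_zero]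

lemma kappa_mul_signSum_starTree {n : ℕ} {γ : Fin n → Charge X} {c : Fin n → V} {K : Type}
    [Fintype K] {g : K → Fin n → Fin b → ℝ} (hγ : ∀ i, ∑ j, dirac γ i j = 0)
    (hc : Function.Bijective c) (hg : OrthonormalFor (formB γ) g)
    (hspan : ∀ φ : V → ℝ, chi γ (φ ∘ c) ∈ Submodule.span ℝ (Set.range g)) (j : Fin n)
    [Fintype (starTree (c j)).1.edgeSet] :
    ((starTree (c j)).toOGraph o).kappa γ c * ((starTree (c j)).toOGraph o).signSum γ c =
      (∏ i with i ≠ j, dirac γ i j) * ∫ a, ∏ i with i ≠ j,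
        Real.sign (formB γ (chi γ (({i} : Set (Fin n)).indicator 1)) (∑ k, a k • g k))
          ∂gaussMeasure K := by
  have hT := (starTree (c j)).isTree_toOGraph o
  rw [OGraph.kappa_mul_signSum_eq_integral hT hc.2 hg hspan (edgeDirac_eq_zero hγ hT c)]
  simp only [prod_endDirac_mul_sign_starTree o γ hc, Finset.prod_mul_distrib, integral_const_mul]

variable {γ : Fin 3 → Charge X}

lemma prod_dirac_eq_neg_sq (hγ : ∀ i, ∑ j, dirac γ i j = 0) (j : Fin 3) :
    ∏ i with i ≠ j, dirac γ i j = -dirac γ 0 1 ^ 2 := by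
  have dirac_self (i : Fin 3) : dirac γ i i = 0 := by simp [dirac]
  have dirac_zero_two : dirac γ 0 2 = -dirac γ 0 1 := by
    linarith [hγ 0, Fin.sum_univ_three (dirac γ 0), dirac_self 0]
  have dirac_one_two : dirac γ 1 2 = dirac γ 0 1 := by
    linarith [hγ 1, Fin.sum_univ_three (dirac γ 1), dirac_self 1, dirac_swap γ 0 1]
  fin_cases j <;>
    simp [Finset.prod_filter, Fin.prod_univ_three, dirac_swap γ 0 1, dirac_swap γ 0 2,
      dirac_swap γ 1 2, dirac_zero_two, dirac_one_two, sq]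

/-- Each of the three stars contributes `-γ₀₁²` times the mean of a product of two out of three
signs, and these means add up to `-1`. -/
lemma sum_kappa_mul_signSum [Fintype V] {c : Fin 3 → V} (hc : Function.Bijective c)
    (hγ : ∀ i, ∑ j, dirac γ i j = 0) :
    ∑ G : TreeOn V, (G.toOGraph o).kappa γ c * (G.toOGraph o).signSum γ c = dirac γ 0 1 ^ 2 := by
  have hV : Fintype.card V = 3 := by simp [← Fintype.card_of_bijective hc]
  obtain ⟨g, hg, hspan⟩ :=
    OGraph.exists_orthonormalFor γ ((starTree (c 0)).isTree_toOGraph o) hc.2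
  set w : Fin 3 → Fin 3 → Fin b → ℝ := fun s => chi γ (({s} : Set (Fin 3)).indicator 1)
  have w_zero_mem : w 0 ∈ Submodule.span ℝ (Set.range g) := by
    simp only [w, ← preimage_singleton_apply hc.1 (0 : Fin 3)]
    exact hspan (({c 0} : Set V).indicator 1)
  have w_zero_ne_zero : w 0 ≠ 0 := chi_indicator_ne_zero γ rfl (j := 1) (by simp)
  have cyclic := integral_prod_sign_mul_cyclic hg w_zero_mem w_zero_ne_zero
    (sum_chi_indicator_fiber γ id) Empty.elim
  have mean_sum : ∑ j, ∫ a, ∏ i with i ≠ j, Real.sign (formB γ (w i) (∑ k, a k • g k))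
      ∂gaussMeasure (starTree (c 0)).1.edgeSet = -1 := by
    simp only [Finset.univ_eq_empty, Finset.prod_empty, one_mul, integral_const, probReal_univ,
      smul_eq_mul, mul_one] at cyclic
    have pairs (f : Fin 3 → ℝ) : ∏ i with i ≠ 0, f i = f 2 * f 1 ∧
        ∏ i with i ≠ 1, f i = f 2 * f 0 ∧ ∏ i with i ≠ 2, f i = f 1 * f 0 := by
      simp [Finset.prod_filter, Fin.prod_univ_three, mul_comm]
    rw [← cyclic, Fin.sum_univ_three, add_right_comm]
    simp only [pairs]
  rw [← (starTree_bijective_of_card_eq_three hV).sum_comp, ← hc.sum_comp]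
  simp only [kappa_mul_signSum_starTree o hγ hc hg hspan, prod_dirac_eq_neg_sq hγ]
  rw [← Finset.mul_sum, mean_sum, neg_mul_neg, mul_one]

end ThreeCharges

section Example

/-- The intersection numbers with `p³ = 3 (p¹)² p²`. -/
def exKappa (i j k : Fin 2) : ℤ := if i.val + j.val + k.val = 1 then 1 else 0

lemma cubic_exKappa (p q r : Fin 2 → ℤ) :
    cubic exKappa p q r = p 0 * q 0 * r 1 + p 0 * q 1 * r 0 + p 1 * q 0 * r 0 := by
  simp [cubic, exKappa, Fin.sum_univ_two]

lemma tripleForm_exKappa (x y z : Fin 2 → ℝ) :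
    tripleForm exKappa z x y = x 0 * y 0 * z 1 + x 0 * y 1 * z 0 + x 1 * y 0 * z 0 := by
  simp [tripleForm_apply, exKappa, Fin.sum_univ_two]

/-- The classes with positive components, which are the effective divisors of the example. -/
def exDiv : Set (Fin 2 → ℤ) := {p | 0 < p 0 ∧ 0 < p 1}

/-- The generators of the cone dual to `exDiv`, which are the effective curves of the example. -/
def exCurve : Set (Fin 2 → ℤ) := {![1, 0], ![0, 1]}

lemma inChargeCone_exKappa_iff {p : Fin 2 → ℤ} :
    InChargeCone exKappa exDiv exCurve p ↔ p ∈ exDiv := by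
  constructor
  · rintro ⟨-, -, curve_pos⟩
    exact ⟨by simpa using curve_pos ![1, 0] (.inl rfl), by simpa using curve_pos ![0, 1] (.inr rfl)⟩
  · rintro ⟨h0, h1⟩
    refine ⟨?_, ?_, ?_⟩
    · rw [cubic_exKappa]
      positivity
    · rintro r ⟨hr0, hr1⟩
      rw [cubic_exKappa]
      positivity
    · rintro k (rfl | rfl) <;> simpa

lemma signature_exKappa {p : Fin 2 → ℤ} (hp : p ∈ exDiv) :
    sigPos (kappaMat exKappa p).toQuadraticForm' = 1 ∧
      sigNeg (kappaMat exKappa p).toQuadraticForm' = 1 := by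
  have h0 : (0 : ℝ) < p 0 := by exact_mod_cast hp.1
  have h1 : (0 : ℝ) < p 1 := by exact_mod_cast hp.2
  set β := tripleForm exKappa (realVec p)
  have pos : 1 ≤ sigPos β.toQuadraticMap := one_le_sigPos_of_pos (x := ![1, 0]) <| by
    simpa [β, tripleForm_exKappa, realVec] using h1
  have neg : 1 ≤ sigPos (-β).toQuadraticMap := one_le_sigPos_of_pos (x := ![p 0, -p 1]) <| by
    have value : (-β) ![p 0, -p 1] ![p 0, -p 1] = (p 0 : ℝ) ^ 2 * p 1 := by
      simp [β, tripleForm_exKappa, realVec]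
      ring
    rw [value]
    positivity
  have rank := QuadraticForm.sigPos_add_sigNeg_add_radical (Q := β.toQuadraticMap)
  rw [Module.finrank_fin_fun] at rank
  rw [LinearMap.BilinMap.toQuadraticMap_neg, sigPos_neg] at neg
  change sigPos β.toQuadraticMap = 1 ∧ sigNeg β.toQuadraticMap = 1
  omega

/-- Intersection data with two classes and a non-degenerate cone of charges. -/
def exData : IntersectionData 2 where
  κ := exKappa
  κ_swap_left i j k := by simp only [exKappa, add_comm i.val]
  κ_swap_right i j k := by simp only [exKappa, add_assoc, add_comm j.val]
  effDiv := exDiv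
  effCurve := exCurve
  cone_add p p' := by
    simp only [inChargeCone_exKappa_iff]
    exact fun h h' => ⟨add_pos h.1 h'.1, add_pos h.2 h'.2⟩
  cone_effective p := inChargeCone_exKappa_iff.1
  signature_pos p hp := (signature_exKappa (inChargeCone_exKappa_iff.1 hp)).1
  signature_neg p hp := by rw [(signature_exKappa (inChargeCone_exKappa_iff.1 hp)).2]

/-- The D4-brane charges of the example. -/
def exP : Fin 3 → Fin 2 → ℤ := ![![2, 1], ![2, 2], ![4, 1]]

/-- The D2-brane charges of the example. -/
def exQ : Fin 3 → Fin 2 → ℝ := ![![0, -1], ![2, -7], ![0, 0]]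

/-- Three charges with `γ₁₂ = γ₂₃ = γ₃₁ = 1`, so that `Γ_e = 0` for all edges of all trees. -/
def exCharge (i : Fin 3) : Charge exData where
  p := exP i
  q := exQ i
  p_mem := by
    refine inChargeCone_exKappa_iff.2 ⟨?_, ?_⟩ <;> fin_cases i <;> simp [exP]
  q_mem a := by
    refine ⟨![![-2, -3], ![-2, -9], ![-4, -8]] i a, ?_⟩
    fin_cases i <;> fin_cases a <;>
      simp [exData, exP, exQ, kappaMat, exKappa, Fin.sum_univ_two] <;> norm_num

lemma dirac_exCharge (i j : Fin 3) : dirac exCharge i j =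
    exP j 0 * exQ i 0 - exP i 0 * exQ j 0 + (exP j 1 * exQ i 1 - exP i 1 * exQ j 1) := by
  simp only [dirac, exCharge, Fin.sum_univ_two]

lemma dirac_exCharge_zero_one : dirac exCharge 0 1 = 1 := by
  rw [dirac_exCharge]
  norm_num [exP, exQ]

lemma sum_dirac_exCharge (i : Fin 3) : ∑ j, dirac exCharge i j = 0 := by
  simp only [dirac_exCharge, Fin.sum_univ_three]
  fin_cases i <;> simp [exP, exQ] <;> norm_num

end Example

section Naive

lemma OGraph.aCoef_of_unique {V E : Type} (T : OGraph V E) [Fintype V] [Unique V] [Fintype E]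
    [IsEmpty E] : T.aCoef = 1 := by
  have erase_eq_empty (v : V) : (Finset.univ : Finset V).erase v = ∅ := by
    ext w
    simp [Subsingleton.elim w v]
  have prod_comps (v : V) :
      ∏ C : {C // C ∈ T.comps (Finset.univ.erase v)}, T.aSub C.1 = 1 := by
    rw [Finset.prod_coe_sort _ T.aSub, erase_eq_empty]
    rfl
  rw [OGraph.aCoef, OGraph.aSub]
  simp only [prod_comps]
  simp [inDeg]

variable {b n : ℕ} {X : IntersectionData b} (o : ∀ V : Type, EdgeOrientation V)
  (γ : Fin n → Charge X) {P : Finpartition (Finset.univ : Finset (Fin n))}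

lemma TreeOn.isEmpty_edgeSet {V : Type} [Subsingleton V] (G : TreeOn V) : IsEmpty G.1.edgeSet := by
  rw [Subsingleton.elim G.1 ⊥, SimpleGraph.edgeSet_bot]
  infer_instance

lemma markFactor_of_card_eq_one {B : Finset (Fin n)} (hB : B.card = 1) :
    markFactor o γ B = 1 := by
  obtain ⟨i, rfl⟩ := Finset.card_eq_one.1 hB
  have : Subsingleton (TreeOn {j // j ∈ ({i} : Finset (Fin n))}) :=
    ⟨fun G G' => Subtype.ext (Subsingleton.elim _ _)⟩
  have := (starTree (default : {j // j ∈ ({i} : Finset (Fin n))})).isEmpty_edgeSet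
  rw [markFactor, Fintype.sum_subsingleton _ (starTree default), OGraph.aCoef_of_unique]
  simp

lemma blockOf_bijective_of_card (hP : P.parts.card = n) : Function.Bijective (blockOf P) :=
  (Fintype.bijective_iff_surjective_and_card _).2
    ⟨blockOf_surjective P, by rw [Fintype.card_fin, Fintype.card_coe, hP]⟩

lemma card_block_eq_one (hP : P.parts.card = n) (B : Blocks P) : B.1.card = 1 := by
  obtain ⟨i, rfl⟩ := blockOf_surjective P B
  refine Finset.card_eq_one.2 ⟨i, Finset.eq_singleton_iff_unique_mem.2
    ⟨P.mem_part (Finset.mem_univ i), fun j hj => ?_⟩⟩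
  refine (blockOf_bijective_of_card hP).1 (Subtype.ext ?_)
  exact P.part_eq_of_mem (P.part_mem.2 (Finset.mem_univ i)) hj

lemma markedPartitions_nonempty (n : ℕ) : (markedPartitions n 0).Nonempty :=
  ⟨⊥, by simp +contextual [markedPartitions]⟩

/-- The contribution of the partition `P` to the difference between `vertexLimit` and
`naiveVertexLimit`. -/
def signCorrection (P : Finpartition (Finset.univ : Finset (Fin n))) : ℝ :=
  (∏ B : Blocks P, markFactor o γ B.1) * ∑ G : TreeOn (Blocks P),
    (G.toOGraph (o _)).kappa γ (blockOf P) *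
      ((G.toOGraph (o _)).signSum γ (blockOf P) - (G.toOGraph (o _)).signProd γ (blockOf P))

lemma vertexLimit_sub_naiveVertexLimit : vertexLimit o γ - naiveVertexLimit o γ =
    1 / (n.factorial : ℝ) * ∑ m ∈ Finset.range ((n - 1) / 2 + 1),
      ∑ P ∈ markedPartitions n m, signCorrection o γ P := by
  simp only [vertexLimit, naiveVertexLimit, signCorrection, ← mul_sub, ← Finset.sum_sub_distrib,
    Finset.mul_sum, mul_assoc]

lemma signCorrection_of_card_parts_eq_one (hP : P.parts.card = 1) : signCorrection o γ P = 0 := by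
  have : Subsingleton (Blocks P) := Fintype.card_le_one_iff_subsingleton.1 (by simp [hP])
  refine mul_eq_zero_of_right _ (Finset.sum_eq_zero fun G _ => ?_)
  rw [OGraph.signSum_eq_signProd (G.isTree_toOGraph _) (blockOf_surjective P)
    G.isEmpty_edgeSet.elim, sub_self, mul_zero]

lemma signCorrection_of_card_parts_eq_three {γ : Fin 3 → Charge X}
    (hγ : ∀ i, ∑ j, dirac γ i j = 0) {P : Finpartition (Finset.univ : Finset (Fin 3))}
    (hP : P.parts.card = 3) : signCorrection o γ P = dirac γ 0 1 ^ 2 := by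
  have markFactor_eq_one (B : Blocks P) : markFactor o γ B.1 = 1 :=
    markFactor_of_card_eq_one o γ (card_block_eq_one hP B)
  have one_lt_card : 1 < Fintype.card (Blocks P) := by simp [hP]
  simp only [signCorrection, markFactor_eq_one, signProd_toOGraph_eq_zero _ hγ one_lt_card,
    sub_zero, Finset.prod_const_one, one_mul]
  convert sum_kappa_mul_signSum (o _) (blockOf_bijective_of_card hP) hγ

/-- The trees with a mark have no edges, and each way of distributing the charges over the
vertices of an unmarked tree contributes `γ₁₂²` to the difference. -/
lemma vertexLimit_ne_naiveVertexLimit {γ : Fin 3 → Charge X} (hγ : ∀ i, ∑ j, dirac γ i j = 0)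
    (hd : dirac γ 0 1 ≠ 0) : vertexLimit o γ ≠ naiveVertexLimit o γ := by
  have card_parts {m : ℕ} {P : Finpartition (Finset.univ : Finset (Fin 3))}
      (hP : P ∈ markedPartitions 3 m) : P.parts.card + 2 * m = 3 :=
    (Finset.mem_filter.1 hP).2.1
  have unmarked : ∑ P ∈ markedPartitions 3 0, signCorrection o γ P =
      (markedPartitions 3 0).card * dirac γ 0 1 ^ 2 := by
    rw [Finset.sum_congr rfl fun P hP =>
      signCorrection_of_card_parts_eq_three o hγ (card_parts hP), Finset.sum_const, nsmul_eq_mul]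
  have marked : ∑ P ∈ markedPartitions 3 1, signCorrection o γ P = 0 :=
    Finset.sum_eq_zero fun P hP => signCorrection_of_card_parts_eq_one o γ
      (by have := card_parts hP; omega)
  have card_ne_zero : ((markedPartitions 3 0).card : ℝ) ≠ 0 :=
    Nat.cast_ne_zero.2 (markedPartitions_nonempty 3).card_ne_zero
  rw [← sub_ne_zero, vertexLimit_sub_naiveVertexLimit,
    show Finset.range ((3 - 1) / 2 + 1) = Finset.range 2 from rfl,
    Finset.sum_range_succ, Finset.sum_range_one, unmarked, marked,
    add_zero]
  exact mul_ne_zero (one_div_ne_zero (Nat.cast_ne_zero.2 (Nat.factorial_ne_zero 3)))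
    (mul_ne_zero card_ne_zero (pow_ne_zero 2 hd))

end Naive

end

end D4Completion

theorem mainTheorem2 :
    -- the limit formula, for all charges and all choices of orientations of the edges
    (∀ (o : ∀ V : Type, D4Completion.EdgeOrientation V) (b n : ℕ) (_ : 1 ≤ n)
      (X : D4Completion.IntersectionData b) (γ : Fin n → D4Completion.Charge X),
      Filter.Tendsto (D4Completion.vertexFn o γ) Filter.atTop
        (nhds (D4Completion.vertexLimit o γ))) ∧
    -- the identity for the coefficients at `x = 0`; the contracted tree on the right can be
    -- obtained from any of the three trees
    (∀ (b n : ℕ) (X : D4Completion.IntersectionData b) (γ : Fin n → D4Completion.Charge X)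
      (V E : Fin 3 → Type) [∀ r, Fintype (E r)] (T : ∀ r, D4Completion.OGraph (V r) (E r))
      (u : ∀ r, V r) (c : Fin n → Σ r, V r),
      (∀ r, (T r).IsTree) → Function.Surjective c → ∀ r : Fin 3,
        (D4Completion.hatTree T u 0).treeErr γ c 0 + (D4Completion.hatTree T u 1).treeErr γ c 0
            - (D4Completion.hatTree T u 2).treeErr γ c 0 =
          -((D4Completion.hatTree T u r).eContract γ c D4Completion.oldEdges)) ∧
    -- the product of signs alone does not give the limit for all charges
    (∀ o : ∀ V : Type, D4Completion.EdgeOrientation V,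
      ∃ (b n : ℕ) (X : D4Completion.IntersectionData b) (γ : Fin n → D4Completion.Charge X),
        1 ≤ n ∧ ¬ Filter.Tendsto (D4Completion.vertexFn o γ) Filter.atTop
          (nhds (D4Completion.naiveVertexLimit o γ))) :=
  ⟨fun o _ _ _ _ γ => D4Completion.tendsto_vertexFn o γ,
    fun _ _ _ _ _ _ _ _ _ _ hT hc r => D4Completion.treeErr_hatTree hT hc r,
    fun o => ⟨2, 3, D4Completion.exData, D4Completion.exCharge, by norm_num, fun h =>
      D4Completion.vertexLimit_ne_naiveVertexLimit o D4Completion.sum_dirac_exCharge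
        (by simp [D4Completion.dirac_exCharge_zero_one])
        (tendsto_nhds_unique (D4Completion.tendsto_vertexFn o _) h)⟩⟩
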